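/- Let $N\ge 1$, $s\in(0,1)$, let $\Omega\subset\mathbb R^N$ be a bounded open set (for instance a bounded Lipschitz domain), and let $p:\mathbb R^N\times\mathbb R^N\to\mathbb R$ be continuous and symmetric, $p(x,y)=p(y,x)$, with $1<\inf p\le\sup p<N/s$. Put $\bar p(x)=p(x,x)$. Let $X$ be the space of (classes of a.e. equal) measurable functions $u:\mathbb R^N\to\mathbb R$ with $$\int_{\mathbb R^N}|u|^{\bar p(x)}\,dx<\infty,\qquad \int_{\mathbb R^N}\int_{\mathbb R^N}\frac{|u(x)-u(y)|^{p(x,y)}}{|x-y|^{N+sp(x,y)}}\,dx\,dy<\infty,\qquad u=0 \text{ a.e. in }\mathbb R^N\setminus\Omega,$$ normed by $\|u\|_X=K(u)$, where $$K(u)=[u]_{s,p(\cdot,\cdot)}=\inf\Big\{\lambda>0:\ \int_{\mathbb R^N}\int_{\mathbb R^N}\Big|\frac{u(x)-u(y)}{\lambda}\Big|^{p(x,y)}\frac{1}{|x-y|^{N+sp(x,y)}}\,\frac{dx\,dy}{p(x,y)}<1\Big\}.$$ Let also $$k(u)=\|u\|_{\bar p,\Omega}=\inf\Big\{\lambda>0:\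 \int_\Omega\Big|\frac{u(x)}{\lambda}\Big|^{\bar p(x)}\frac{dx}{\bar p(x)}\le 1\Big\},\qquad \mathcal M=\{u\in X:\ k(u)=1\}.$$ Then near every point $u\in\mathcal M$ the functionals $K$ and $k$ are of class $C^1$ on $X$, and $k'(u)\neq0$ (so $\mathcal M$ is a $C^1$ submanifold of $X$ with tangent space $T_u\mathcal M=\ker k'(u)$), and the restriction $\tilde K=K|_{\mathcal M}$ satisfies the Palais--Smale condition: if $c\in\mathbb R$ and $(u_n)\subset\mathcal M$ satisfy $K(u_n)\to c$ and $\|\tilde K'(u_n)\|\to0$, where $\tilde K'(u_n)=K'(u_n)|_{\ker k'(u_n)}$ and the norm is that of the dual of $\ker k'(u_n)\subset X$, then $(u_n)$ has a subsequence converging in $X$ to an element of $\mathcal M$. -/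

import Mathlib

open MeasureTheory Filter Topology
open scoped ENNReal

namespace FracVar

noncomputable section

/-- The Euclidean space `ℝ^N`. -/
abbrev Space (N : ℕ) := EuclideanSpace ℝ (Fin N)

/-- A continuous symmetric exponent `p : ℝ^N × ℝ^N → ℝ` with `1 < inf p ≤ sup p < N / s`. -/
structure AdmissibleExponent (N : ℕ) (s : ℝ) where
  toFun : Space N → Space N → ℝ
  continuous_toFun : Continuous fun z : Space N × Space N => toFun z.1 z.2
  symm : ∀ x y, toFun x y = toFun y x
  exists_lower : ∃ a : ℝ, 1 < a ∧ ∀ x y, a ≤ toFun x y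
  exists_upper : ∃ b : ℝ, b < (N : ℝ) / s ∧ ∀ x y, toFun x y ≤ b

variable {N : ℕ} {s : ℝ}

instance : CoeFun (AdmissibleExponent N s) fun _ => Space N → Space N → ℝ :=
  ⟨AdmissibleExponent.toFun⟩

/-- `∫_{ℝ^N} |f(x)|^{p(x,x)} dx`. -/
def lebesgueEnergy (p : AdmissibleExponent N s) (f : Space N → ℝ) : ℝ≥0∞ :=
  ∫⁻ x, ENNReal.ofReal (|f x| ^ p x x)

/-- `∫∫ |f(x) - f(y)|^{p(x,y)} / |x - y|^{N + s p(x,y)} dx dy` over `ℝ^N × ℝ^N`. -/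
def gagliardoEnergy (p : AdmissibleExponent N s) (f : Space N → ℝ) : ℝ≥0∞ :=
  ∫⁻ z : Space N × Space N,
    ENNReal.ofReal (|f z.1 - f z.2| ^ p z.1 z.2 / ‖z.1 - z.2‖ ^ ((N : ℝ) + s * p z.1 z.2))

/-- `∫∫ |f(x) - f(y)|^{p(x,y)} / |x - y|^{N + s p(x,y)} dx dy / p(x,y)` over `ℝ^N × ℝ^N`. -/
def gagliardoModular (p : AdmissibleExponent N s) (f : Space N → ℝ) : ℝ≥0∞ :=
  ∫⁻ z : Space N × Space N,
    ENNReal.ofReal (|f z.1 - f z.2| ^ p z.1 z.2 / ‖z.1 - z.2‖ ^ ((N : ℝ) + s * p z.1 z.2)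
      / p z.1 z.2)

/-- The Luxemburg seminorm `[f]_{s,p(·,·)}` on `ℝ^N`. -/
def gagliardoNorm (p : AdmissibleExponent N s) (f : Space N → ℝ) : ℝ :=
  sInf {l : ℝ | 0 < l ∧ gagliardoModular p (fun x => f x / l) < 1}

/-- The Luxemburg norm `‖f‖_{p̄,Ω}` with `p̄(x) = p(x,x)` and the measure `dx / p̄(x)`. -/
def lebesgueNorm (p : AdmissibleExponent N s) (Ω : Set (Space N)) (f : Space N → ℝ) : ℝ :=
  sInf {l : ℝ | 0 < l ∧ ∫⁻ x in Ω, ENNReal.ofReal (|f x / l| ^ p x x / p x x) ≤ 1}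

/-! Auxiliary facts on weighted modulars `∫ |h|^q w`. -/

section Aux

variable {Z : Type*} [MeasurableSpace Z] {μ : Measure Z} {q w : Z → ℝ} {b : ℝ}

lemma aux_scale_le {t x q : ℝ} (ht0 : 0 ≤ t) (ht1 : t ≤ 1) (hq : 1 ≤ q) :
    |t * x| ^ q ≤ t * |x| ^ q := by
  rw [abs_mul, abs_of_nonneg ht0, Real.mul_rpow ht0 (abs_nonneg _)]
  gcongr
  calc t ^ q ≤ t ^ (1 : ℝ) := Real.rpow_le_rpow_of_exponent_ge_of_imp ht0 ht1 hq (by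
        intro _ h; linarith)
    _ = t := Real.rpow_one t

lemma aux_conv {x y l m q : ℝ} (hl : 0 < l) (hm : 0 < m) (hq : 1 ≤ q) :
    |(x + y) / (l + m)| ^ q ≤ l / (l + m) * |x / l| ^ q + m / (l + m) * |y / m| ^ q := by
  have hlm : 0 < l + m := by positivity
  have h1 : |(x + y) / (l + m)| ≤ l / (l + m) * |x / l| + m / (l + m) * |y / m| := by
    have : (x + y) / (l + m) = l / (l + m) * (x / l) + m / (l + m) * (y / m) := by
      field_simp
    rw [this]
    refine (abs_add_le _ _).trans (le_of_eq ?_)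
    rw [abs_mul, abs_mul, abs_of_pos (div_pos hl hlm), abs_of_pos (div_pos hm hlm)]
  refine (Real.rpow_le_rpow (abs_nonneg _) h1 (by linarith)).trans ?_
  have := (convexOn_rpow hq).2 (x := |x / l|) (y := |y / m|)
    (Set.mem_Ici.2 (abs_nonneg _)) (Set.mem_Ici.2 (abs_nonneg _))
    (div_pos hl hlm).le (div_pos hm hlm).le (by field_simp)
  simpa using this

lemma aux_lintegral_scale (hw : ∀ z, 0 ≤ w z) (hq1 : ∀ z, 1 ≤ q z) (hqb : ∀ z, q z ≤ b)
    {h : Z → ℝ} (hfin : ∫⁻ z, ENNReal.ofReal (|h z| ^ q z * w z) ∂μ < ⊤) (c : ℝ) :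
    ∫⁻ z, ENNReal.ofReal (|c * h z| ^ q z * w z) ∂μ < ⊤ := by
  have key : ∀ z, ENNReal.ofReal (|c * h z| ^ q z * w z) ≤
      ENNReal.ofReal ((1 + |c|) ^ b) * ENNReal.ofReal (|h z| ^ q z * w z) := by
    intro z
    rw [← ENNReal.ofReal_mul (by positivity)]
    apply ENNReal.ofReal_le_ofReal
    rw [abs_mul, Real.mul_rpow (abs_nonneg _) (abs_nonneg _), ← mul_assoc]
    have hz := hw z
    have h1 : |c| ^ q z ≤ (1 + |c|) ^ b :=
      (Real.rpow_le_rpow (abs_nonneg _) (by linarith) (by linarith [hq1 z])).trans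
        (Real.rpow_le_rpow_of_exponent_le (by linarith [abs_nonneg c]) (hqb z))
    gcongr
  refine (lintegral_mono key).trans_lt ?_
  rw [lintegral_const_mul' _ _ ENNReal.ofReal_ne_top]
  exact ENNReal.mul_lt_top ENNReal.ofReal_lt_top hfin

lemma aux_lintegral_le_scale (hw : ∀ z, 0 ≤ w z) (hq1 : ∀ z, 1 ≤ q z)
    (h : Z → ℝ) {t : ℝ} (ht0 : 0 ≤ t) (ht1 : t ≤ 1) :
    ∫⁻ z, ENNReal.ofReal (|t * h z| ^ q z * w z) ∂μ ≤
      ENNReal.ofReal t * ∫⁻ z, ENNReal.ofReal (|h z| ^ q z * w z) ∂μ := by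
  rw [← lintegral_const_mul' _ _ ENNReal.ofReal_ne_top]
  refine lintegral_mono fun z => ?_
  rw [← ENNReal.ofReal_mul ht0]
  apply ENNReal.ofReal_le_ofReal
  rw [← mul_assoc]
  exact mul_le_mul_of_nonneg_right (aux_scale_le ht0 ht1 (hq1 z)) (hw z)

lemma aux_lintegral_conv (hw : ∀ z, 0 ≤ w z) (hq1 : ∀ z, 1 ≤ q z)
    (hwm : Measurable w) (hqm : Measurable q) {h g : Z → ℝ} (hh : Measurable h)
    {l m : ℝ} (hl : 0 < l) (hm : 0 < m) :
    ∫⁻ z, ENNReal.ofReal (|(h z + g z) / (l + m)| ^ q z * w z) ∂μ ≤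
      ENNReal.ofReal (l / (l + m)) * ∫⁻ z, ENNReal.ofReal (|h z / l| ^ q z * w z) ∂μ +
      ENNReal.ofReal (m / (l + m)) * ∫⁻ z, ENNReal.ofReal (|g z / m| ^ q z * w z) ∂μ := by
  rw [← lintegral_const_mul' _ _ ENNReal.ofReal_ne_top,
    ← lintegral_const_mul' _ _ ENNReal.ofReal_ne_top, ← lintegral_add_left (by fun_prop)]
  refine lintegral_mono fun z => ?_
  have hz := hw z
  rw [← ENNReal.ofReal_mul (by positivity), ← ENNReal.ofReal_mul (by positivity),
    ← ENNReal.ofReal_add (by positivity) (by positivity)]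
  apply ENNReal.ofReal_le_ofReal
  have := mul_le_mul_of_nonneg_right
    (aux_conv (x := h z) (y := g z) hl hm (hq1 z)) hz
  linarith

lemma aux_lintegral_add (hw : ∀ z, 0 ≤ w z) (hq1 : ∀ z, 1 ≤ q z) (hqb : ∀ z, q z ≤ b)
    (hwm : Measurable w) (hqm : Measurable q) {h g : Z → ℝ} (hh : Measurable h)
    (hfin : ∫⁻ z, ENNReal.ofReal (|h z| ^ q z * w z) ∂μ < ⊤)
    (gfin : ∫⁻ z, ENNReal.ofReal (|g z| ^ q z * w z) ∂μ < ⊤) :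
    ∫⁻ z, ENNReal.ofReal (|h z + g z| ^ q z * w z) ∂μ < ⊤ := by
  have h1 : ∫⁻ z, ENNReal.ofReal (|(h z + g z) / (1 + 1)| ^ q z * w z) ∂μ < ⊤ := by
    refine (aux_lintegral_conv hw hq1 hwm hqm hh one_pos one_pos).trans_lt ?_
    simp only [div_one]
    exact ENNReal.add_lt_top.2 ⟨ENNReal.mul_lt_top ENNReal.ofReal_lt_top hfin,
      ENNReal.mul_lt_top ENNReal.ofReal_lt_top gfin⟩
  have h2 := aux_lintegral_scale hw hq1 hqb h1 2
  have h3 : ∀ z, 2 * ((h z + g z) / (1 + 1)) = h z + g z := fun z => by ring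
  simpa only [h3] using h2

end Aux

namespace AdmissibleExponent

variable (p : AdmissibleExponent N s)

lemma one_le (x y : Space N) : 1 ≤ p x y := by
  obtain ⟨a, ha, h⟩ := p.exists_lower
  linarith [h x y]

lemma pos (x y : Space N) : 0 < p x y := one_pos.trans_le (p.one_le x y)

lemma measurable : Measurable fun z : Space N × Space N => p z.1 z.2 :=
  p.continuous_toFun.measurable

lemma measurable_diag : Measurable fun x : Space N => p x x :=
  p.measurable.comp (measurable_id.prodMk measurable_id)

lemma dim_pos (p : AdmissibleExponent N s) : 0 < N := by
  rcases Nat.eq_zero_or_pos N with h | h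
  · obtain ⟨b, hb, h'⟩ := p.exists_upper
    subst h
    have := p.pos 0 0
    have := h' 0 0
    simp at hb
    linarith
  · exact h

/-- The weight `|x - y|^{-(N + s p(x,y))}`. -/
def weight (z : Space N × Space N) : ℝ := (‖z.1 - z.2‖ ^ ((N : ℝ) + s * p z.1 z.2))⁻¹

lemma weight_nonneg (z : Space N × Space N) : 0 ≤ p.weight z := by
  unfold weight; positivity

lemma weight_measurable : Measurable p.weight := by
  have := p.measurable
  unfold weight
  fun_prop

/-- The weight `|x - y|^{-(N + s p(x,y))} / p(x,y)`. -/
def weightDiv (z : Space N × Space N) : ℝ := p.weight z * (p z.1 z.2)⁻¹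

lemma weightDiv_nonneg (z : Space N × Space N) : 0 ≤ p.weightDiv z :=
  mul_nonneg (p.weight_nonneg z) (inv_nonneg.2 (p.pos _ _).le)

lemma weightDiv_measurable : Measurable p.weightDiv :=
  p.weight_measurable.mul p.measurable.inv

end AdmissibleExponent

lemma gagliardoEnergy_eq (p : AdmissibleExponent N s) (f : Space N → ℝ) :
    gagliardoEnergy p f = ∫⁻ z : Space N × Space N,
      ENNReal.ofReal (|f z.1 - f z.2| ^ p z.1 z.2 * p.weight z) := rfl

lemma gagliardoModular_eq (p : AdmissibleExponent N s) (f : Space N → ℝ) :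
    gagliardoModular p f = ∫⁻ z : Space N × Space N,
      ENNReal.ofReal (|f z.1 - f z.2| ^ p z.1 z.2 * p.weightDiv z) := by
  unfold gagliardoModular AdmissibleExponent.weightDiv AdmissibleExponent.weight
  simp only [div_eq_mul_inv, mul_assoc]

lemma lebesgueEnergy_eq (p : AdmissibleExponent N s) (f : Space N → ℝ) :
    lebesgueEnergy p f = ∫⁻ x, ENNReal.ofReal (|f x| ^ p x x * (fun _ => 1) x) := by
  simp [lebesgueEnergy]

lemma ae_prod_congr {f g : Space N → ℝ} (h : f =ᵐ[volume] g) :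
    ∀ᵐ z : Space N × Space N, f z.1 = g z.1 ∧ f z.2 = g z.2 :=
  (Measure.quasiMeasurePreserving_fst.ae h).and (Measure.quasiMeasurePreserving_snd.ae h)

lemma lebesgueEnergy_congr (p : AdmissibleExponent N s) {f g : Space N → ℝ}
    (h : f =ᵐ[volume] g) : lebesgueEnergy p f = lebesgueEnergy p g :=
  lintegral_congr_ae (h.mono fun x hx => by simp only [hx])

lemma gagliardoEnergy_congr (p : AdmissibleExponent N s) {f g : Space N → ℝ}
    (h : f =ᵐ[volume] g) : gagliardoEnergy p f = gagliardoEnergy p g :=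
  lintegral_congr_ae ((ae_prod_congr h).mono fun z hz => by simp only [hz.1, hz.2])

lemma gagliardoModular_congr (p : AdmissibleExponent N s) {f g : Space N → ℝ}
    (h : f =ᵐ[volume] g) : gagliardoModular p f = gagliardoModular p g :=
  lintegral_congr_ae ((ae_prod_congr h).mono fun z hz => by simp only [hz.1, hz.2])

lemma gagliardoNorm_congr (p : AdmissibleExponent N s) {f g : Space N → ℝ}
    (h : f =ᵐ[volume] g) : gagliardoNorm p f = gagliardoNorm p g := by
  have : ∀ l : ℝ, gagliardoModular p (fun x => f x / l) = gagliardoModular p (fun x => g x / l) :=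
    fun l => gagliardoModular_congr p (h.mono fun x hx => by simp only [hx])
  simp only [gagliardoNorm, this]

lemma lebesgueEnergy_zero (p : AdmissibleExponent N s) :
    lebesgueEnergy p (fun _ => 0) = 0 := by
  simp [lebesgueEnergy, Real.zero_rpow (p.pos _ _).ne']

lemma gagliardoEnergy_zero (p : AdmissibleExponent N s) :
    gagliardoEnergy p (fun _ => 0) = 0 := by
  simp [gagliardoEnergy, Real.zero_rpow (p.pos _ _).ne']

lemma gagliardoModular_zero (p : AdmissibleExponent N s) :
    gagliardoModular p (fun _ => 0) = 0 := by
  simp [gagliardoModular, Real.zero_rpow (p.pos _ _).ne']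

/-- The space `W^{s,p̄,p(·,·)}(ℝ^N)`, made of classes of measurable functions modulo equality
almost everywhere. -/
def W (p : AdmissibleExponent N s) : Submodule ℝ (Space N →ₘ[volume] ℝ) where
  carrier := {u | lebesgueEnergy p u < ⊤ ∧ gagliardoEnergy p u < ⊤}
  zero_mem' := by
    have h := AEEqFun.coeFn_zero (α := Space N) (μ := volume) (β := ℝ)
    refine ⟨?_, ?_⟩
    · rw [lebesgueEnergy_congr p h]
      exact (lebesgueEnergy_zero p).trans_lt ENNReal.zero_lt_top
    · rw [gagliardoEnergy_congr p h]
      exact (gagliardoEnergy_zero p).trans_lt ENNReal.zero_lt_top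
  add_mem' := by
    intro u v hu hv
    obtain ⟨b, -, hb⟩ := p.exists_upper
    have h := AEEqFun.coeFn_add u v
    have hum := u.stronglyMeasurable.measurable
    refine ⟨?_, ?_⟩
    · have h1 := hu.1
      have h2 := hv.1
      rw [lebesgueEnergy_eq] at h1 h2
      rw [lebesgueEnergy_congr p h, lebesgueEnergy_eq]
      exact aux_lintegral_add (fun _ => zero_le_one) (fun x => p.one_le x x) (fun x => hb x x)
        measurable_const p.measurable_diag hum h1 h2
    · have h1 := hu.2
      have h2 := hv.2
      rw [gagliardoEnergy_eq] at h1 h2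
      rw [gagliardoEnergy_congr p h, gagliardoEnergy_eq]
      have := aux_lintegral_add p.weight_nonneg (fun z => p.one_le z.1 z.2)
        (fun z => hb z.1 z.2) p.weight_measurable p.measurable
        (h := fun z : Space N × Space N => u z.1 - u z.2)
        (g := fun z : Space N × Space N => v z.1 - v z.2) (by fun_prop) h1 h2
      simpa only [Pi.add_apply, add_sub_add_comm] using this
  smul_mem' := by
    intro c u hu
    obtain ⟨b, -, hb⟩ := p.exists_upper
    have h := AEEqFun.coeFn_smul c u
    refine ⟨?_, ?_⟩
    · have h1 := hu.1
      rw [lebesgueEnergy_eq] at h1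
      rw [lebesgueEnergy_congr p h, lebesgueEnergy_eq]
      exact aux_lintegral_scale (fun _ => zero_le_one) (fun x => p.one_le x x)
        (fun x => hb x x) h1 c
    · have h1 := hu.2
      rw [gagliardoEnergy_eq] at h1
      rw [gagliardoEnergy_congr p h, gagliardoEnergy_eq]
      have := aux_lintegral_scale p.weight_nonneg (fun z => p.one_le z.1 z.2)
        (fun z => hb z.1 z.2) h1 c
      simpa only [Pi.smul_apply, smul_eq_mul, ← mul_sub] using this

/-- The space `X` of those `u` in `W^{s,p̄,p(·,·)}(ℝ^N)` with `u = 0` almost everywhere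
outside `Ω`. -/
def X (p : AdmissibleExponent N s) (Ω : Set (Space N)) :
    Submodule ℝ (Space N →ₘ[volume] ℝ) where
  carrier := {u | u ∈ W p ∧ ∀ᵐ x, x ∉ Ω → u x = 0}
  zero_mem' := by
    refine ⟨(W p).zero_mem, ?_⟩
    filter_upwards [AEEqFun.coeFn_zero (α := Space N) (μ := volume) (β := ℝ)] with x hx _
    simp [hx]
  add_mem' := by
    intro u v hu hv
    refine ⟨(W p).add_mem hu.1 hv.1, ?_⟩
    filter_upwards [AEEqFun.coeFn_add u v, hu.2, hv.2] with x hx h1 h2 hxΩ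
    simp [hx, h1 hxΩ, h2 hxΩ]
  smul_mem' := by
    intro c u hu
    refine ⟨(W p).smul_mem c hu.1, ?_⟩
    filter_upwards [AEEqFun.coeFn_smul c u, hu.2] with x hx h1 hxΩ
    simp [hx, h1 hxΩ]

/-- The functional `K(u) = [u]_{s,p(·,·)}` on `X`. -/
def K (p : AdmissibleExponent N s) (Ω : Set (Space N)) (u : X p Ω) : ℝ :=
  gagliardoNorm p (u : Space N →ₘ[volume] ℝ)

/-- The functional `k(u) = ‖u‖_{p̄,Ω}` on `X`. -/
def k (p : AdmissibleExponent N s) (Ω : Set (Space N)) (u : X p Ω) : ℝ :=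
  lebesgueNorm p Ω (u : Space N →ₘ[volume] ℝ)

/-! `K` is a norm on `X`. -/

lemma gagliardoNorm_bddBelow (p : AdmissibleExponent N s) (f : Space N → ℝ) :
    BddBelow {l : ℝ | 0 < l ∧ gagliardoModular p (fun x => f x / l) < 1} :=
  ⟨0, fun _ hl => hl.1.le⟩

lemma gagliardoModular_le_scale (p : AdmissibleExponent N s) (f : Space N → ℝ) {t : ℝ}
    (ht0 : 0 ≤ t) (ht1 : t ≤ 1) :
    gagliardoModular p (fun x => t * f x) ≤ ENNReal.ofReal t * gagliardoModular p f := by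
  rw [gagliardoModular_eq, gagliardoModular_eq]
  have := aux_lintegral_le_scale (μ := volume) p.weightDiv_nonneg (fun z => p.one_le z.1 z.2)
    (fun z : Space N × Space N => f z.1 - f z.2) ht0 ht1
  simpa only [← mul_sub] using this

lemma gagliardoModular_le_energy (p : AdmissibleExponent N s) (f : Space N → ℝ) :
    gagliardoModular p f ≤ gagliardoEnergy p f := by
  rw [gagliardoModular_eq, gagliardoEnergy_eq]
  refine lintegral_mono fun z => ENNReal.ofReal_le_ofReal ?_
  have h1 : p.weightDiv z ≤ p.weight z :=
    mul_le_of_le_one_right (p.weight_nonneg z) (inv_le_one_of_one_le₀ (p.one_le _ _))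
  gcongr

lemma gagliardoNorm_set_nonempty (p : AdmissibleExponent N s) {f : Space N → ℝ}
    (hf : gagliardoEnergy p f < ⊤) :
    {l : ℝ | 0 < l ∧ gagliardoModular p (fun x => f x / l) < 1}.Nonempty := by
  have hfin : gagliardoModular p f ≠ ⊤ := ((gagliardoModular_le_energy p f).trans_lt hf).ne
  set A := (gagliardoModular p f).toReal with hA
  have hA0 : 0 ≤ A := ENNReal.toReal_nonneg
  have hpos : (0 : ℝ) < A + 1 := by linarith
  refine ⟨A + 1, hpos, ?_⟩
  have h1 := gagliardoModular_le_scale p f (t := (A + 1)⁻¹) (by positivity)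
    (inv_le_one_of_one_le₀ (by linarith))
  have h2 : (fun x => f x / (A + 1)) = fun x => (A + 1)⁻¹ * f x := by
    funext x; rw [div_eq_inv_mul]
  rw [h2]
  refine h1.trans_lt ?_
  rw [← ENNReal.ofReal_toReal hfin, ← hA, ← ENNReal.ofReal_mul (by positivity),
    ← ENNReal.ofReal_one, ENNReal.ofReal_lt_ofReal_iff one_pos, ← div_eq_inv_mul,
    div_lt_one hpos]
  linarith

lemma gagliardoNorm_nonneg (p : AdmissibleExponent N s) (f : Space N → ℝ) :
    0 ≤ gagliardoNorm p f :=
  Real.sInf_nonneg fun _ hl => hl.1.le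

lemma gagliardoNorm_smul (p : AdmissibleExponent N s) (c : ℝ) (f : Space N → ℝ) :
    gagliardoNorm p (fun x => c * f x) = |c| * gagliardoNorm p f := by
  rcases eq_or_ne c 0 with rfl | hc
  · have : {l : ℝ | 0 < l ∧ gagliardoModular p (fun x => 0 * f x / l) < 1} = Set.Ioi 0 := by
      ext l
      simp [gagliardoModular_zero]
    rw [gagliardoNorm, this, csInf_Ioi]
    simp
  · have hc' : 0 < |c| := abs_pos.2 hc
    have habs : ∀ l : ℝ, gagliardoModular p (fun x => c * f x / l) =
        gagliardoModular p (fun x => f x / (|c|⁻¹ * l)) := by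
      intro l
      unfold gagliardoModular
      refine lintegral_congr fun z => ?_
      have : |c * f z.1 / l - c * f z.2 / l| =
          |f z.1 / (|c|⁻¹ * l) - f z.2 / (|c|⁻¹ * l)| := by
        rw [← sub_div, ← sub_div, ← mul_sub, abs_div, abs_div, abs_mul, abs_mul, abs_inv,
          abs_abs, mul_comm |c|, inv_mul_eq_div, div_div_eq_mul_div]
      rw [this]
    have hset : {l : ℝ | 0 < l ∧ gagliardoModular p (fun x => c * f x / l) < 1} =
        (fun l => |c| * l) '' {l : ℝ | 0 < l ∧ gagliardoModular p (fun x => f x / l) < 1} := by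
      ext l
      constructor
      · rintro ⟨h1, h2⟩
        refine ⟨|c|⁻¹ * l, ⟨by positivity, ?_⟩, by field_simp⟩
        rwa [← habs]
      · rintro ⟨l, ⟨h1, h2⟩, rfl⟩
        refine ⟨by positivity, ?_⟩
        rw [habs, inv_mul_cancel_left₀ hc'.ne']
        exact h2
    have := Real.sInf_smul_of_nonneg (abs_nonneg c)
      {l : ℝ | 0 < l ∧ gagliardoModular p (fun x => f x / l) < 1}
    rw [gagliardoNorm, gagliardoNorm, hset]
    exact this

lemma gagliardoNorm_add (p : AdmissibleExponent N s) {f g : Space N → ℝ} (hfm : Measurable f)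
    (hf : gagliardoEnergy p f < ⊤) (hg : gagliardoEnergy p g < ⊤) :
    gagliardoNorm p (fun x => f x + g x) ≤ gagliardoNorm p f + gagliardoNorm p g := by
  have key : ∀ l ∈ {l : ℝ | 0 < l ∧ gagliardoModular p (fun x => f x / l) < 1},
      ∀ m ∈ {l : ℝ | 0 < l ∧ gagliardoModular p (fun x => g x / l) < 1},
      gagliardoNorm p (fun x => f x + g x) ≤ l + m := by
    rintro l ⟨hl, hfl⟩ m ⟨hm, hgm⟩
    refine csInf_le (gagliardoNorm_bddBelow _ _) ⟨by positivity, ?_⟩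
    have h1 := aux_lintegral_conv (μ := volume) p.weightDiv_nonneg (fun z => p.one_le z.1 z.2)
      p.weightDiv_measurable p.measurable
      (h := fun z : Space N × Space N => f z.1 - f z.2)
      (g := fun z : Space N × Space N => g z.1 - g z.2) (by fun_prop) hl hm
    have e : ∀ z : Space N × Space N, (f z.1 - f z.2 + (g z.1 - g z.2)) / (l + m) =
        (f z.1 + g z.1) / (l + m) - (f z.2 + g z.2) / (l + m) := fun z => by ring
    simp only [e, sub_div (f _), sub_div (g _)] at h1
    rw [← gagliardoModular_eq p (fun x => (f x + g x) / (l + m)),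
      ← gagliardoModular_eq p (fun x => f x / l),
      ← gagliardoModular_eq p (fun x => g x / m)] at h1
    refine h1.trans_lt ?_
    have hsum : ENNReal.ofReal (l / (l + m)) * 1 + ENNReal.ofReal (m / (l + m)) * 1 = 1 := by
      rw [mul_one, mul_one, ← ENNReal.ofReal_add (by positivity) (by positivity), ← add_div,
        div_self (by positivity), ENNReal.ofReal_one]
    refine lt_of_lt_of_eq (ENNReal.add_lt_add ?_ ?_) hsum
    · exact (ENNReal.mul_lt_mul_iff_right (by simp; positivity) ENNReal.ofReal_ne_top).2 hfl
    · exact (ENNReal.mul_lt_mul_iff_right (by simp; positivity) ENNReal.ofReal_ne_top).2 hgm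
  have h2 : ∀ l ∈ {l : ℝ | 0 < l ∧ gagliardoModular p (fun x => f x / l) < 1},
      gagliardoNorm p (fun x => f x + g x) - l ≤ gagliardoNorm p g := fun l hl =>
    le_csInf (gagliardoNorm_set_nonempty p hg) fun m hm => by linarith [key l hl m hm]
  have h3 : gagliardoNorm p (fun x => f x + g x) - gagliardoNorm p g ≤ gagliardoNorm p f :=
    le_csInf (gagliardoNorm_set_nonempty p hf) fun l hl => by linarith [h2 l hl]
  linarith

lemma ae_eq_zero_of_gagliardoNorm_eq_zero (p : AdmissibleExponent N s) {f : Space N → ℝ}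
    (hfm : Measurable f) (hfL : lebesgueEnergy p f < ⊤) (hf : gagliardoEnergy p f < ⊤)
    (h0 : gagliardoNorm p f = 0) : f =ᵐ[volume] fun _ => 0 := by
  have hmod : gagliardoModular p f = 0 := by
    refine le_antisymm (le_of_forall_pos_le_add fun ε hε => ?_) zero_le
    obtain ⟨δ, hδ0, hδ⟩ : ∃ δ : ℝ, 0 < δ ∧ ENNReal.ofReal δ ≤ ε := by
      rcases eq_or_ne ε ⊤ with rfl | h
      · exact ⟨1, one_pos, le_top⟩
      · exact ⟨ε.toReal, ENNReal.toReal_pos hε.ne' h, ENNReal.ofReal_toReal_le⟩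
    have hlt : gagliardoNorm p f < min δ 1 := by rw [h0]; positivity
    obtain ⟨l, ⟨hl, hl1⟩, hlδ⟩ := exists_lt_of_csInf_lt (gagliardoNorm_set_nonempty p hf) hlt
    have h1 := gagliardoModular_le_scale p (fun x => f x / l) hl.le
      (hlδ.le.trans (min_le_right _ _))
    have e : (fun x => l * (f x / l)) = f := by funext x; field_simp
    rw [e] at h1
    rw [zero_add]
    refine h1.trans ((mul_le_of_le_one_right zero_le hl1.le).trans ?_)
    exact (ENNReal.ofReal_le_ofReal (hlδ.le.trans (min_le_left _ _))).trans hδ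
  have hae : ∀ᵐ z : Space N × Space N, f z.1 = f z.2 := by
    rw [gagliardoModular_eq, lintegral_eq_zero_iff (by
      have := p.measurable
      have := p.weightDiv_measurable
      fun_prop)] at hmod
    filter_upwards [hmod] with z hz
    by_contra hne
    have hzz : z.1 - z.2 ≠ 0 := fun h => hne (by rw [sub_eq_zero.1 h])
    have h1 : 0 < |f z.1 - f z.2| := abs_pos.2 (sub_ne_zero.2 hne)
    have h2 : 0 < ‖z.1 - z.2‖ := norm_pos_iff.2 hzz
    have h3 := p.pos z.1 z.2
    have h4 : 0 < |f z.1 - f z.2| ^ p z.1 z.2 * p.weightDiv z := by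
      unfold AdmissibleExponent.weightDiv AdmissibleExponent.weight
      positivity
    simp only [Pi.zero_apply, ENNReal.ofReal_eq_zero] at hz
    linarith
  have : Nonempty (Fin N) := ⟨⟨0, p.dim_pos⟩⟩
  have : NoncompactSpace (Space N) := NormedSpace.noncompactSpace ℝ (Space N)
  obtain ⟨x, hx⟩ := (Measure.ae_ae_of_ae_prod hae).exists
  by_cases hc : f x = 0
  · filter_upwards [hx] with y hy
    rw [← hy, hc]
  · exfalso
    obtain ⟨b, -, hb⟩ := p.exists_upper
    have hcpos : 0 < |f x| := abs_pos.2 hc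
    have hmin : 0 < min |f x| 1 := lt_min hcpos one_pos
    have h1 : ENNReal.ofReal ((min |f x| 1) ^ b) * volume (Set.univ : Set (Space N)) ≤
        lebesgueEnergy p f := by
      rw [← lintegral_const]
      refine lintegral_mono_ae ?_
      filter_upwards [hx] with y hy
      apply ENNReal.ofReal_le_ofReal
      rw [← hy]
      exact (Real.rpow_le_rpow_of_exponent_ge hmin (min_le_right _ _) (hb y y)).trans
        (Real.rpow_le_rpow hmin.le (min_le_left _ _) (p.pos y y).le)
    rw [measure_univ_of_isAddLeftInvariant, ENNReal.mul_top (by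
      simp only [ne_eq, ENNReal.ofReal_eq_zero, not_le]; positivity)] at h1
    exact absurd (h1.trans_lt hfL) (lt_irrefl _)

/-- The norm `‖u‖_X = [u]_{s,p(·,·)}` on `X`. -/
instance (p : AdmissibleExponent N s) (Ω : Set (Space N)) : Norm (X p Ω) := ⟨K p Ω⟩

lemma X_normCore (p : AdmissibleExponent N s) (Ω : Set (Space N)) :
    NormedSpace.Core ℝ (X p Ω) where
  norm_nonneg u := gagliardoNorm_nonneg p _
  norm_smul c u := by
    change gagliardoNorm p _ = |c| * gagliardoNorm p _
    rw [← gagliardoNorm_smul]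
    exact gagliardoNorm_congr p (AEEqFun.coeFn_smul c (u : Space N →ₘ[volume] ℝ))
  norm_triangle u v := by
    change gagliardoNorm p _ ≤ gagliardoNorm p _ + gagliardoNorm p _
    refine le_trans (le_of_eq ?_) (gagliardoNorm_add p
      (u : Space N →ₘ[volume] ℝ).stronglyMeasurable.measurable u.2.1.2 v.2.1.2)
    exact gagliardoNorm_congr p (AEEqFun.coeFn_add (u : Space N →ₘ[volume] ℝ) v)
  norm_eq_zero_iff u := by
    constructor
    · intro h
      apply Subtype.ext
      apply AEEqFun.ext
      refine (ae_eq_zero_of_gagliardoNorm_eq_zero p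
        (u : Space N →ₘ[volume] ℝ).stronglyMeasurable.measurable u.2.1.1 u.2.1.2 h).trans ?_
      exact (AEEqFun.coeFn_zero (α := Space N) (μ := volume) (β := ℝ)).symm
    · rintro rfl
      change gagliardoNorm p _ = 0
      have h := gagliardoNorm_smul p 0 (fun _ => 0)
      simp only [abs_zero, zero_mul] at h
      rw [← h]
      exact gagliardoNorm_congr p (AEEqFun.coeFn_zero (α := Space N) (μ := volume) (β := ℝ))

instance (p : AdmissibleExponent N s) (Ω : Set (Space N)) : NormedAddCommGroup (X p Ω) :=
  NormedAddCommGroup.ofCore (X_normCore p Ω)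

instance (p : AdmissibleExponent N s) (Ω : Set (Space N)) : NormedSpace ℝ (X p Ω) :=
  NormedSpace.ofCore (X_normCore p Ω)

/-! The Palais–Smale condition on a level set. -/

section PalaisSmale

variable {V : Type*} [NormedAddCommGroup V] [NormedSpace ℝ V]

/-- The derivative at `u` of the restriction of `F` to the level set of `G` through `u`: the
restriction of `F'(u)` to the tangent space `ker G'(u)`. -/
def tangentialDeriv (F G : V → ℝ) (u : V) : (fderiv ℝ G u).ker →L[ℝ] ℝ :=
  (fderiv ℝ F u).comp (fderiv ℝ G u).ker.subtypeL

/-- The Palais–Smale condition for the restriction of `F` to `{u | G u = 1}`. -/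
def PalaisSmale (F G : V → ℝ) : Prop :=
  ∀ (c : ℝ) (u : ℕ → V), (∀ n, G (u n) = 1) →
    Tendsto (fun n => F (u n)) atTop (𝓝 c) →
    Tendsto (fun n => ‖tangentialDeriv F G (u n)‖) atTop (𝓝 0) →
    ∃ φ : ℕ → ℕ, StrictMono φ ∧ ∃ v : V, G v = 1 ∧ Tendsto (fun n => u (φ n)) atTop (𝓝 v)

end PalaisSmale

end

end FracVar

namespace FracVar

noncomputable section

/-! ### Pointwise inequalities for `|x| ^ q` -/

/-! Both functionals are Luxemburg gauges of modulars `ρ(u) = ∫ |T u| ^ q` with `T` linear and `1 <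
a ≤ q ≤ b`: for `K`, `T u` is the difference `u(x) - u(y)` under a weighted product measure; for
`k`, it is `u` itself on `Ω`. The smoothness and convexity arguments are carried out once, for such
modulars (`ModularMap`, `IsGauge`).

Smoothness: a modular tending to `0` at `0` is convex and `C¹` (`contDiff_modular`). Since `ρ'(u) u
≥ ρ(u)`, the implicit function theorem applied to `ρ(t u) = 1` makes the gauge `C¹` away from its
zeros (`IsGauge.contDiffAt`). Euler's identity `k'(u) u = k(u) = 1` shows that `k'(u) ≠ 0`.

Palais–Smale (`palaisSmale_of_isGauge`): `K` is the norm, so the sequence is bounded, and by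
compactness a subsequence `w` satisfies `k(w_m - w_n) → 0`. Subtracting `κ w_m` with `|κ| ≤ k(w_m -
w_n)` makes `w_m - w_n` tangent at `w_m`; hence `K'(w_m)(w_m - w_n) → 0`. As `|K'(w_m) v| ≤ K(v)`
and `K'(w_m) w_m = K(w_m)`, the midpoints of the normalised vectors `w_m / K(w_m)` and `w_n /
K(w_n)` have norms tending to `1`. Uniform convexity makes the normalised sequence Cauchy, and
completeness concludes.

Compactness comes from a direct estimate: `f(x)` is compared with its average over a small ball, the
error being controlled by the Gagliardo energy at `x`. Letting the radius depend on this energy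
bounds `|f(x)| ^ p(x,x)` by an affine function of it (`abs_rpow_le_energy`); fixed small balls show
that finitely many averages control the `L¹` norm up to a small error
(`exists_integral_abs_le_of_averages`). Extracting a subsequence along which all averages converge
gives `X_compact`. -/

/-- On a compact set, a continuous function which is negative on the zero set of a nonnegative
continuous function `g` is dominated by a multiple of `g`. -/
lemma exists_forall_le_mul_of_isCompact {α : Type*} [TopologicalSpace α] {S : Set α}
    (hS : IsCompact S) {f g : α → ℝ} (hf : ContinuousOn f S) (hg : ContinuousOn g S)
    (hg0 : ∀ x ∈ S, 0 ≤ g x) (h : ∀ x ∈ S, g x = 0 → f x < 0) :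
    ∃ C : ℝ, 0 ≤ C ∧ ∀ x ∈ S, f x ≤ C * g x := by
  -- Only the compact part of `S` where `f ≥ 0` matters; `g` has a positive minimum there.
  have hT : IsCompact (S ∩ f ⁻¹' Set.Ici 0) := by
    obtain ⟨t, ht, hft⟩ := (continuousOn_iff_isClosed.1 hf) (Set.Ici 0) isClosed_Ici
    rw [Set.inter_comm, hft, Set.inter_comm]
    exact hS.inter_right ht
  rcases (S ∩ f ⁻¹' Set.Ici 0).eq_empty_or_nonempty with he | hne
  · refine ⟨0, le_rfl, fun x hx => ?_⟩
    by_contra! hlt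
    rw [zero_mul] at hlt
    exact Set.notMem_empty x (he ▸ ⟨hx, hlt.le⟩)
  obtain ⟨x₀, hx₀, hmin⟩ := hT.exists_isMinOn hne (hg.mono Set.inter_subset_left)
  obtain ⟨x₁, hx₁, hmax⟩ := hT.exists_isMaxOn hne (hf.mono Set.inter_subset_left)
  have hpos : 0 < g x₀ := lt_of_le_of_ne (hg0 _ hx₀.1) fun h0 =>
    (h x₀ hx₀.1 h0.symm).not_ge hx₀.2
  have hf1 : 0 ≤ f x₁ := hx₁.2
  refine ⟨f x₁ / g x₀, by positivity, fun x hx => ?_⟩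
  rcases lt_or_ge (f x) 0 with hlt | hge
  · exact hlt.le.trans (mul_nonneg (by positivity) (hg0 x hx))
  · have h1 : f x ≤ f x₁ := hmax ⟨hx, hge⟩
    have h2 : g x₀ ≤ g x := hmin ⟨hx, hge⟩
    calc f x ≤ f x₁ / g x₀ * g x₀ := by rw [div_mul_cancel₀ _ hpos.ne']; exact h1
      _ ≤ _ := by gcongr

/-- A version of `exists_forall_le_mul_of_isCompact` for families of functions which are
positively homogeneous of degree `q ∈ [a, b]`. -/
lemma exists_forall_le_mul_of_homogeneous {E : Type*} [NormedAddCommGroup E] [NormedSpace ℝ E]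
    [FiniteDimensional ℝ E] {a b : ℝ} {f g : ℝ → E → ℝ}
    (hf : ContinuousOn (fun x : ℝ × E => f x.1 x.2) (Set.Icc a b ×ˢ Set.univ))
    (hg : ContinuousOn (fun x : ℝ × E => g x.1 x.2) (Set.Icc a b ×ˢ Set.univ))
    (hft : ∀ q ∈ Set.Icc a b, ∀ t : ℝ, 0 < t → ∀ z, f q (t • z) = t ^ q * f q z)
    (hgt : ∀ q ∈ Set.Icc a b, ∀ t : ℝ, 0 < t → ∀ z, g q (t • z) = t ^ q * g q z)
    (hf0 : ∀ q ∈ Set.Icc a b, f q 0 ≤ 0)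
    (hg0 : ∀ q ∈ Set.Icc a b, ∀ z, 0 ≤ g q z)
    (h : ∀ q ∈ Set.Icc a b, ∀ z, z ≠ 0 → g q z = 0 → f q z < 0) :
    ∃ C : ℝ, 0 ≤ C ∧ ∀ q ∈ Set.Icc a b, ∀ z, f q z ≤ C * g q z := by
  have : ProperSpace E := FiniteDimensional.proper ℝ E
  obtain ⟨C, hC0, hC⟩ := exists_forall_le_mul_of_isCompact
    (isCompact_Icc (a := a) (b := b) |>.prod (isCompact_sphere (0 : E) 1))
    (hf.mono (Set.prod_mono_right (Set.subset_univ _)))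
    (hg.mono (Set.prod_mono_right (Set.subset_univ _)))
    (fun x hx => hg0 _ hx.1 _)
    (fun x hx h0 => h _ hx.1 _ (fun hz => by simp [hz] at hx) h0)
  refine ⟨C, hC0, fun q hq z => ?_⟩
  rcases eq_or_ne z 0 with rfl | hz
  · exact (hf0 q hq).trans (mul_nonneg hC0 (hg0 q hq _))
  have hz' : 0 < ‖z‖ := norm_pos_iff.2 hz
  have e : z = ‖z‖ • (‖z‖⁻¹ • z) := by rw [smul_smul, mul_inv_cancel₀ hz'.ne', one_smul]
  have := hC (q, ‖z‖⁻¹ • z) ⟨hq, by simp [norm_smul, hz'.ne']⟩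
  rw [e, hft q hq _ hz', hgt q hq _ hz', mul_left_comm]
  exact mul_le_mul_of_nonneg_left this (by positivity)

/-- The derivative of `x ↦ |x| ^ q`. -/
def absPowDeriv (q x : ℝ) : ℝ := q * ((max x 0) ^ (q - 1) - (max (-x) 0) ^ (q - 1))

/-- The definition involves only the positive exponent `q - 1`, so joint continuity in `(q, x)` can
be read off from it; `|x| ^ (q - 2)` is singular at `0` when `q < 2`. -/
lemma absPowDeriv_eq {q x : ℝ} (hq : 1 < q) : absPowDeriv q x = q * |x| ^ (q - 2) * x := by
  have hq' : q - 1 ≠ 0 := by linarith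
  unfold absPowDeriv
  rcases lt_trichotomy x 0 with hx | rfl | hx
  · rw [max_eq_right hx.le, max_eq_left (by linarith), Real.zero_rpow hq', abs_of_neg hx,
      show q - 1 = q - 2 + 1 by ring, Real.rpow_add_one (by linarith)]
    ring
  · simp [Real.zero_rpow hq']
  · rw [max_eq_left hx.le, max_eq_right (by linarith), Real.zero_rpow hq', abs_of_pos hx,
      show q - 1 = q - 2 + 1 by ring, Real.rpow_add_one (by linarith)]
    ring

lemma hasDerivAt_absPow {q : ℝ} (hq : 1 < q) (x : ℝ) :
    HasDerivAt (fun x : ℝ => |x| ^ q) (absPowDeriv q x) x := by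
  rw [absPowDeriv_eq hq]
  exact hasDerivAt_abs_rpow x hq

lemma absPowDeriv_zero {q : ℝ} (hq : 1 < q) : absPowDeriv q 0 = 0 := by
  rw [absPowDeriv_eq hq, mul_zero]

lemma absPowDeriv_mul {q t : ℝ} (ht : 0 ≤ t) (x : ℝ) :
    absPowDeriv q (t * x) = t ^ (q - 1) * absPowDeriv q x := by
  unfold absPowDeriv
  rw [← mul_neg, ← mul_zero t, ← mul_max_of_nonneg _ _ ht, ← mul_max_of_nonneg _ _ ht, mul_zero,
    Real.mul_rpow ht (le_max_right _ _), Real.mul_rpow ht (le_max_right _ _)]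
  ring

lemma absPowDeriv_mul_self {q : ℝ} (hq : 1 < q) (x : ℝ) :
    absPowDeriv q x * x = q * |x| ^ q := by
  rw [absPowDeriv_eq hq]
  rcases eq_or_ne x 0 with rfl | hx
  · simp [Real.zero_rpow (show q ≠ 0 by linarith)]
  · have : |x| ^ q = |x| ^ (q - 2) * (x * x) := by
      rw [← abs_mul_abs_self, ← mul_assoc, ← Real.rpow_add_one (abs_ne_zero.2 hx),
        ← Real.rpow_add_one (abs_ne_zero.2 hx)]
      congr 1; ring
    rw [this]; ring

lemma abs_mul_rpow {t : ℝ} (ht : 0 ≤ t) (x q : ℝ) : |t * x| ^ q = t ^ q * |x| ^ q := by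
  rw [abs_mul, abs_of_nonneg ht, Real.mul_rpow ht (abs_nonneg _)]

lemma convexOn_absPow {q : ℝ} (hq : 1 ≤ q) : ConvexOn ℝ Set.univ fun x : ℝ => |x| ^ q := by
  refine ⟨convex_univ, fun x _ y _ s t hs ht hst => ?_⟩
  refine le_trans (Real.rpow_le_rpow (abs_nonneg _) (z := q)
    (?_ : |s • x + t • y| ≤ s • |x| + t • |y|) (by linarith)) ?_
  · simpa [abs_mul, abs_of_nonneg hs, abs_of_nonneg ht] using abs_add_le (s * x) (t * y)
  · exact (convexOn_rpow hq).2 (abs_nonneg x) (abs_nonneg y) hs ht hst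

/-- A convex function lies above its tangent lines; this is the only input from convexity in the
Fréchet differentiability of the modular. -/
lemma absPow_add_ge {q : ℝ} (hq : 1 < q) (x y : ℝ) :
    |x| ^ q + absPowDeriv q x * y ≤ |x + y| ^ q := by
  have hc := convexOn_absPow hq.le
  have hd := hasDerivAt_absPow hq x
  rcases lt_trichotomy y 0 with hy | rfl | hy
  · have := hc.slope_le_of_hasDerivAt (Set.mem_univ (x + y)) (Set.mem_univ x) (by linarith) hd
    rw [slope_def_field, div_le_iff₀ (by linarith)] at this
    linarith
  · simp
  · have := hc.le_slope_of_hasDerivAt (Set.mem_univ x) (Set.mem_univ (x + y)) (by linarith) hd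
    rw [slope_def_field, le_div_iff₀ (by linarith)] at this
    linarith

lemma continuousOn_absPow {α : Type*} [TopologicalSpace α] {S : Set α} {q x : α → ℝ}
    (hq : ContinuousOn q S) (hx : ContinuousOn x S) (h : ∀ z ∈ S, 0 < q z) :
    ContinuousOn (fun z => |x z| ^ q z) S :=
  hx.abs.rpow hq fun z hz => Or.inr (h z hz)

lemma continuousOn_absPowDeriv {α : Type*} [TopologicalSpace α] {S : Set α} {q x : α → ℝ}
    (hq : ContinuousOn q S) (hx : ContinuousOn x S) (h : ∀ z ∈ S, 1 < q z) :
    ContinuousOn (fun z => absPowDeriv (q z) (x z)) S := by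
  unfold absPowDeriv
  refine hq.mul (ContinuousOn.sub ?_ ?_)
  · exact (hx.sup continuousOn_const).rpow (hq.sub continuousOn_const)
      fun z hz => Or.inr (by linarith [h z hz])
  · exact (hx.neg.sup continuousOn_const).rpow (hq.sub continuousOn_const)
      fun z hz => Or.inr (by linarith [h z hz])

lemma measurable_absPowDeriv {Z : Type*} [MeasurableSpace Z] {q f : Z → ℝ} (hq : Measurable q)
    (hf : Measurable f) : Measurable fun z => absPowDeriv (q z) (f z) := by
  unfold absPowDeriv
  fun_prop

/-- The continuity of the superposition operator induced by `absPowDeriv`, in pointwise form. -/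
lemma exists_absPowDeriv_sub_mul_le {a b : ℝ} (ha : 1 < a) {ε : ℝ} (hε : 0 < ε) :
    ∃ C : ℝ, 0 ≤ C ∧ ∀ q ∈ Set.Icc a b, ∀ x y h : ℝ,
      |(absPowDeriv q (x + y) - absPowDeriv q x) * h| ≤
        ε * (|x| ^ q + |h| ^ q) + C * |y| ^ q := by
  -- Every term is homogeneous of degree `q` in `(x, y, h)`. Where `|y| ^ q = 0` the difference of
  -- derivatives vanishes and only the negative term `-ε (|x| ^ q + |h| ^ q)` is left.
  obtain ⟨C, hC0, hC⟩ := exists_forall_le_mul_of_homogeneous (E := ℝ × ℝ × ℝ) (a := a) (b := b)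
    (f := fun q z => |(absPowDeriv q (z.1 + z.2.1) - absPowDeriv q z.1) * z.2.2|
      - ε * (|z.1| ^ q + |z.2.2| ^ q))
    (g := fun q z => |z.2.1| ^ q)
    (by
      have h1 : ∀ z ∈ Set.Icc a b ×ˢ (Set.univ : Set (ℝ × ℝ × ℝ)), 1 < z.1 :=
        fun z hz => ha.trans_le hz.1.1
      have h0 : ∀ z ∈ Set.Icc a b ×ˢ (Set.univ : Set (ℝ × ℝ × ℝ)), 0 < z.1 :=
        fun z hz => one_pos.trans (h1 z hz)
      refine ContinuousOn.sub (ContinuousOn.abs (ContinuousOn.mul (ContinuousOn.sub ?_ ?_) ?_))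
        (continuousOn_const.mul (ContinuousOn.add ?_ ?_))
      · exact continuousOn_absPowDeriv (by fun_prop) (by fun_prop) h1
      · exact continuousOn_absPowDeriv (by fun_prop) (by fun_prop) h1
      · fun_prop
      · exact continuousOn_absPow (by fun_prop) (by fun_prop) h0
      · exact continuousOn_absPow (by fun_prop) (by fun_prop) h0)
    (continuousOn_absPow (by fun_prop) (by fun_prop)
      (fun z hz => by have := hz.1.1; linarith))
    (by
      intro q hq t ht z
      simp only [Prod.smul_fst, Prod.smul_snd, smul_eq_mul]
      rw [← mul_add, absPowDeriv_mul ht.le, absPowDeriv_mul ht.le, abs_mul_rpow ht.le,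
        abs_mul_rpow ht.le, ← mul_sub, mul_mul_mul_comm, abs_mul, ← Real.rpow_add_one ht.ne',
        sub_add_cancel, abs_of_pos (by positivity : 0 < t ^ q)]
      ring)
    (by
      intro q hq t ht z
      simp only [Prod.smul_fst, Prod.smul_snd, smul_eq_mul]
      rw [abs_mul_rpow ht.le])
    (by
      intro q hq
      have : q ≠ 0 := by have := hq.1; linarith
      simp [Real.zero_rpow this])
    (fun q hq z => by positivity)
    (by
      rintro q hq ⟨x, y, h⟩ hz h0
      have hq0 : q ≠ 0 := by have := hq.1; linarith
      have hy : y = 0 := by simpa [Real.rpow_eq_zero (abs_nonneg y) hq0] using h0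
      subst hy
      have : 0 < |x| ^ q + |h| ^ q := by
        rcases eq_or_ne x 0 with rfl | hx
        · have hh : h ≠ 0 := fun hh => hz (by simp [hh])
          have := abs_pos.2 hh
          positivity
        · have := abs_pos.2 hx
          positivity
      simp only [add_zero, sub_self, zero_mul, abs_zero, zero_sub, Left.neg_neg_iff]
      positivity)
  refine ⟨C, hC0, fun q hq x y h => ?_⟩
  have := hC q hq (x, y, h)
  simp only at this
  linarith

lemma absPow_midpoint_le {q : ℝ} (hq : 1 ≤ q) (x y : ℝ) :
    |(x + y) / 2| ^ q ≤ (|x| ^ q + |y| ^ q) / 2 := by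
  have := aux_conv (x := x) (y := y) one_pos one_pos hq
  norm_num at this
  linarith

/-- Strict convexity on `[0, ∞)` forces `|x| = |y|`; if `x = -y`, the midpoint is `0`, so both
vanish. -/
lemma eq_of_absPow_midpoint {q x y : ℝ} (hq : 1 < q)
    (h : (|x| ^ q + |y| ^ q) / 2 - |(x + y) / 2| ^ q = 0) : x = y := by
  have h1 : |(x + y) / 2| ^ q ≤ ((|x| + |y|) / 2) ^ q := by
    refine Real.rpow_le_rpow (abs_nonneg _) ?_ (by linarith)
    rw [abs_div, abs_two]
    gcongr
    exact abs_add_le x y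
  have habs : |x| = |y| := by
    by_contra hne
    have := (strictConvexOn_rpow hq).2 (abs_nonneg x) (abs_nonneg y) hne
      (show (0 : ℝ) < 1 / 2 by norm_num) (show (0 : ℝ) < 1 / 2 by norm_num) (by norm_num)
    simp only [smul_eq_mul] at this
    rw [← mul_add, one_div_mul_eq_div] at this
    linarith
  rcases abs_eq_abs.1 habs with h2 | h2
  · exact h2
  · subst h2
    have hq0 : q ≠ 0 := by linarith
    simp only [neg_add_cancel, zero_div, abs_zero, Real.zero_rpow hq0, abs_neg] at h
    have hy : |y| ^ q = 0 := by linarith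
    have : y = 0 := by simpa [Real.rpow_eq_zero (abs_nonneg y) hq0] using hy
    simp [this]

/-- Uniform convexity of `|x| ^ q`, uniformly for `q` in a compact subset of `(1, ∞)`. -/
lemma exists_absPow_sub_le {a b : ℝ} (ha : 1 < a) {ε : ℝ} (hε : 0 < ε) :
    ∃ C : ℝ, 0 ≤ C ∧ ∀ q ∈ Set.Icc a b, ∀ x y : ℝ,
      |x - y| ^ q ≤ ε * (|x| ^ q + |y| ^ q) +
        C * ((|x| ^ q + |y| ^ q) / 2 - |(x + y) / 2| ^ q) := by
  have h0 : ∀ z ∈ Set.Icc a b ×ˢ (Set.univ : Set (ℝ × ℝ)), 0 < z.1 :=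
    fun z hz => by have := hz.1.1; linarith
  -- The convexity defect vanishes only on the diagonal, where the first function is `-2 ε |x| ^ q <
  -- 0` unless `x = 0`.
  obtain ⟨C, hC0, hC⟩ := exists_forall_le_mul_of_homogeneous (E := ℝ × ℝ) (a := a) (b := b)
    (f := fun q z => |z.1 - z.2| ^ q - ε * (|z.1| ^ q + |z.2| ^ q))
    (g := fun q z => (|z.1| ^ q + |z.2| ^ q) / 2 - |(z.1 + z.2) / 2| ^ q)
    (by
      refine ContinuousOn.sub ?_ (continuousOn_const.mul (ContinuousOn.add ?_ ?_)) <;>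
      exact continuousOn_absPow (by fun_prop) (by fun_prop) h0)
    (by
      refine ContinuousOn.sub ((ContinuousOn.add ?_ ?_).div_const 2) ?_ <;>
      exact continuousOn_absPow (by fun_prop) (by fun_prop) h0)
    (by
      intro q hq t ht z
      simp only [Prod.smul_fst, Prod.smul_snd, smul_eq_mul]
      rw [← mul_sub, abs_mul_rpow ht.le, abs_mul_rpow ht.le, abs_mul_rpow ht.le]
      ring)
    (by
      intro q hq t ht z
      simp only [Prod.smul_fst, Prod.smul_snd, smul_eq_mul]
      rw [← mul_add, mul_div_assoc, abs_mul_rpow ht.le, abs_mul_rpow ht.le, abs_mul_rpow ht.le]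
      ring)
    (by
      intro q hq
      have : q ≠ 0 := by have := hq.1; linarith
      simp [Real.zero_rpow this])
    (fun q hq z => sub_nonneg.2 (absPow_midpoint_le (ha.le.trans hq.1) _ _))
    (by
      rintro q hq ⟨x, y⟩ hz h0
      have hxy : x = y := eq_of_absPow_midpoint (ha.trans_le hq.1) h0
      subst hxy
      have hx : x ≠ 0 := fun h => hz (by simp [h])
      have := abs_pos.2 hx
      have hq0 : q ≠ 0 := by have := hq.1; linarith
      simp only [sub_self, abs_zero, Real.zero_rpow hq0, zero_sub, Left.neg_neg_iff]
      positivity)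
  refine ⟨C, hC0, fun q hq x y => ?_⟩
  have := hC q hq (x, y)
  simp only at this
  linarith

/-! ### Modulars `∫ |T u| ^ q` -/

/-- A map `T`, linear up to null sets, from a vector space `E` to the measurable functions with
finite modular `∫ |f| ^ q`, where `1 < a ≤ q ≤ b`. -/
structure ModularMap {Z : Type*} [MeasurableSpace Z] (ν : Measure Z) (q : Z → ℝ) (E : Type*)
    [AddCommGroup E] [Module ℝ E] where
  toFun : E → Z → ℝ
  measurable_toFun : ∀ u, Measurable (toFun u)
  map_add_ae : ∀ u v, ∀ᵐ z ∂ν, toFun (u + v) z = toFun u z + toFun v z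
  map_smul_ae : ∀ (c : ℝ) u, ∀ᵐ z ∂ν, toFun (c • u) z = c * toFun u z
  integrable : ∀ u, Integrable (fun z => |toFun u z| ^ q z) ν
  measurable_exponent : Measurable q
  lower : ℝ
  one_lt_lower : 1 < lower
  upper : ℝ
  mem_Icc : ∀ z, q z ∈ Set.Icc lower upper

namespace ModularMap

variable {Z : Type*} [MeasurableSpace Z] {ν : Measure Z} {q : Z → ℝ}

section Algebraic

variable {E : Type*} [AddCommGroup E] [Module ℝ E]

lemma one_lt_exponent (T : ModularMap ν q E) (z : Z) : 1 < q z :=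
  T.one_lt_lower.trans_le (T.mem_Icc z).1

variable (T : ModularMap ν q E)

/-- The modular `∫ |T u| ^ q`. -/
def modular (u : E) : ℝ := ∫ z, |T.toFun u z| ^ q z ∂ν

lemma modular_nonneg (u : E) : 0 ≤ T.modular u := integral_nonneg fun z => by positivity

lemma modular_smul (t : ℝ) (u : E) :
    T.modular (t • u) = ∫ z, |t * T.toFun u z| ^ q z ∂ν :=
  integral_congr_ae ((T.map_smul_ae t u).mono fun z hz => by simp only [hz])

/-- For `t ≤ 1`, `t ^ q` lies between `t ^ upper` and `t`. The two resulting bounds on `T.modular (t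
• u)` replace the homogeneity lost with a variable exponent. -/
lemma modular_smul_le {t : ℝ} (ht0 : 0 ≤ t) (ht1 : t ≤ 1) (u : E) :
    T.modular (t • u) ≤ t * T.modular u := by
  rw [modular, modular, ← integral_const_mul]
  refine integral_mono_ae (T.integrable _) ((T.integrable u).const_mul t) ?_
  filter_upwards [T.map_smul_ae t u] with z hz
  rw [hz]
  exact aux_scale_le ht0 ht1 (T.one_lt_exponent z).le

lemma le_modular_smul {t : ℝ} (ht0 : 0 < t) (ht1 : t ≤ 1) (u : E) :
    t ^ T.upper * T.modular u ≤ T.modular (t • u) := by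
  rw [modular, modular, ← integral_const_mul]
  refine integral_mono_ae ((T.integrable u).const_mul _) (T.integrable _) ?_
  filter_upwards [T.map_smul_ae t u] with z hz
  rw [hz, abs_mul_rpow ht0.le]
  have := Real.rpow_le_rpow_of_exponent_ge ht0 ht1 (T.mem_Icc z).2
  gcongr

lemma modular_zero : T.modular 0 = 0 := by
  have := T.modular_smul_le le_rfl zero_le_one 0
  rw [zero_smul, zero_mul] at this
  exact le_antisymm this (T.modular_nonneg 0)

lemma modular_convex_comb_le (u v : E) {s t : ℝ} (hs : 0 ≤ s) (ht : 0 ≤ t) (hst : s + t = 1) :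
    T.modular (s • u + t • v) ≤ s * T.modular u + t * T.modular v := by
  rw [modular, modular, modular, ← integral_const_mul, ← integral_const_mul,
    ← integral_add ((T.integrable u).const_mul _) ((T.integrable v).const_mul _)]
  refine integral_mono_ae (T.integrable _)
    (((T.integrable u).const_mul _).add ((T.integrable v).const_mul _)) ?_
  filter_upwards [T.map_smul_ae s u, T.map_smul_ae t v, T.map_add_ae (s • u) (t • v)] with z h1 h2 h3
  rw [h3, h1, h2]
  exact (convexOn_absPow (T.one_lt_exponent z).le).2 (Set.mem_univ _) (Set.mem_univ _) hs ht hst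

lemma map_sub_ae (u v : E) : ∀ᵐ z ∂ν, T.toFun (u - v) z = T.toFun u z - T.toFun v z := by
  filter_upwards [T.map_add_ae u ((-1 : ℝ) • v), T.map_smul_ae (-1) v] with z h1 h2
  rw [sub_eq_add_neg u v, ← neg_one_smul ℝ v, h1, h2]
  ring

/-- Uniform convexity of the modular. -/
lemma exists_modular_sub_le {ε : ℝ} (hε : 0 < ε) : ∃ C : ℝ, 0 ≤ C ∧ ∀ u v : E,
    T.modular (u - v) ≤ ε * (T.modular u + T.modular v) +
      C * ((T.modular u + T.modular v) / 2 - T.modular ((1 / 2 : ℝ) • (u + v))) := by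
  obtain ⟨C, hC0, hC⟩ := exists_absPow_sub_le (b := T.upper) T.one_lt_lower hε
  refine ⟨C, hC0, fun u v => ?_⟩
  have hu := T.integrable u
  have hv := T.integrable v
  have hm := T.integrable ((1 / 2 : ℝ) • (u + v))
  have huv : Integrable (fun z => |T.toFun u z| ^ q z + |T.toFun v z| ^ q z) ν := hu.add hv
  have huvm : Integrable (fun z => (|T.toFun u z| ^ q z + |T.toFun v z| ^ q z) / 2 -
      |T.toFun ((1 / 2 : ℝ) • (u + v)) z| ^ q z) ν := (huv.div_const 2).sub hm
  have h1 : T.modular (u - v) ≤ ∫ z, (ε * (|T.toFun u z| ^ q z + |T.toFun v z| ^ q z) +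
      C * ((|T.toFun u z| ^ q z + |T.toFun v z| ^ q z) / 2 -
        |T.toFun ((1 / 2 : ℝ) • (u + v)) z| ^ q z)) ∂ν := by
    refine integral_mono_ae (T.integrable _)
      ((huv.const_mul ε).add (huvm.const_mul C)) ?_
    filter_upwards [T.map_sub_ae u v, T.map_smul_ae (1 / 2) (u + v), T.map_add_ae u v] with z h1 h2 h3
    rw [h1, h2, h3, one_div_mul_eq_div]
    exact hC _ (T.mem_Icc z) _ _
  refine h1.trans (le_of_eq ?_)
  rw [integral_add (huv.const_mul ε) (huvm.const_mul C),
    integral_const_mul, integral_const_mul, integral_sub (huv.div_const 2) hm,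
    integral_div, integral_add hu hv]
  rfl

lemma integrable_deriv (u v : E) :
    Integrable (fun z => absPowDeriv (q z) (T.toFun u z) * T.toFun v z) ν := by
  obtain ⟨C, hC0, hC⟩ := exists_absPowDeriv_sub_mul_le (b := T.upper) T.one_lt_lower one_pos
  refine Integrable.mono' ((T.integrable v).add ((T.integrable u).const_mul C))
    ((measurable_absPowDeriv T.measurable_exponent (T.measurable_toFun u)).mul
      (T.measurable_toFun v)).aestronglyMeasurable (ae_of_all _ fun z => ?_)
  -- With base point `0` and increment `T u`, the pointwise continuity estimate becomes a Young
  -- inequality.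
  have := hC (q z) (T.mem_Icc z) 0 (T.toFun u z) (T.toFun v z)
  have hq := T.one_lt_exponent z
  rw [zero_add, absPowDeriv_zero hq, sub_zero, abs_zero, Real.zero_rpow (by linarith), zero_add,
    one_mul] at this
  exact this

/-- The Gateaux derivative of the modular. -/
def derivLinear (u : E) : E →ₗ[ℝ] ℝ where
  toFun v := ∫ z, absPowDeriv (q z) (T.toFun u z) * T.toFun v z ∂ν
  map_add' v w := by
    rw [← integral_add (T.integrable_deriv u v) (T.integrable_deriv u w)]
    refine integral_congr_ae ?_
    filter_upwards [T.map_add_ae v w] with z hz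
    rw [hz, mul_add]
  map_smul' c v := by
    rw [RingHom.id_apply, smul_eq_mul, ← integral_const_mul]
    refine integral_congr_ae ?_
    filter_upwards [T.map_smul_ae c v] with z hz
    rw [hz, mul_left_comm]

lemma derivLinear_apply (u v : E) :
    T.derivLinear u v = ∫ z, absPowDeriv (q z) (T.toFun u z) * T.toFun v z ∂ν := rfl

lemma derivLinear_zero (v : E) : T.derivLinear 0 v = 0 := by
  rw [derivLinear_apply]
  have h := T.map_smul_ae 0 0
  rw [zero_smul] at h
  refine integral_eq_zero_of_ae (h.mono fun z hz => ?_)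
  simp only [Pi.zero_apply]
  rw [hz, zero_mul, absPowDeriv_zero (T.one_lt_exponent z), zero_mul]

/-- One estimate with two uses: base point `0` gives boundedness of the derivative, and small `ε`
gives its continuity. -/
lemma exists_derivLinear_sub_le {ε : ℝ} (hε : 0 < ε) : ∃ C : ℝ, 0 ≤ C ∧ ∀ u v w : E,
    |T.derivLinear (u + v) w - T.derivLinear u w| ≤
      ε * (T.modular u + T.modular w) + C * T.modular v := by
  obtain ⟨C, hC0, hC⟩ := exists_absPowDeriv_sub_mul_le (b := T.upper) T.one_lt_lower hε
  refine ⟨C, hC0, fun u v w => ?_⟩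
  have hu := T.integrable u
  have hv := T.integrable v
  have hw := T.integrable w
  have huw : Integrable (fun z => |T.toFun u z| ^ q z + |T.toFun w z| ^ q z) ν := hu.add hw
  rw [derivLinear_apply, derivLinear_apply,
    ← integral_sub (T.integrable_deriv _ _) (T.integrable_deriv _ _)]
  have h1 : ‖∫ z, (absPowDeriv (q z) (T.toFun (u + v) z) * T.toFun w z -
      absPowDeriv (q z) (T.toFun u z) * T.toFun w z) ∂ν‖ ≤
      ∫ z, (ε * (|T.toFun u z| ^ q z + |T.toFun w z| ^ q z) + C * |T.toFun v z| ^ q z) ∂ν := by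
    refine norm_integral_le_of_norm_le ((huw.const_mul ε).add (hv.const_mul C)) ?_
    filter_upwards [T.map_add_ae u v] with z hz
    rw [hz, ← sub_mul]
    exact hC _ (T.mem_Icc z) _ _ _
  refine h1.trans (le_of_eq ?_)
  rw [integral_add (huw.const_mul ε) (hv.const_mul C), integral_const_mul,
    integral_const_mul, integral_add hu hw]
  rfl

lemma modular_add_derivLinear_le (u v : E) :
    T.modular u + T.derivLinear u v ≤ T.modular (u + v) := by
  rw [derivLinear_apply, modular, modular,
    ← integral_add (T.integrable u) (T.integrable_deriv u v)]
  refine integral_mono_ae ((T.integrable u).add (T.integrable_deriv u v)) (T.integrable _) ?_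
  filter_upwards [T.map_add_ae u v] with z hz
  rw [hz]
  exact absPow_add_ge (T.one_lt_exponent z) _ _

/-- The integrand on the right is `q |T u| ^ q` with `q ≥ 1`. This is the nondegeneracy needed by
the implicit function theorem. -/
lemma modular_le_derivLinear_self (u : E) : T.modular u ≤ T.derivLinear u u := by
  rw [derivLinear_apply, modular]
  refine integral_mono (T.integrable u) (T.integrable_deriv u u) fun z => ?_
  have hq := T.one_lt_exponent z
  simp only
  rw [absPowDeriv_mul_self hq]
  exact le_mul_of_one_le_left (by positivity) hq.le

end Algebraic

/-! ### Continuous differentiability of the modular -/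

section Normed

variable {E : Type*} [NormedAddCommGroup E] [NormedSpace ℝ E] (T : ModularMap ν q E)

/-- The modular is at most `1` on a small ball; the lower scaling bound with `t ^ upper` carries
this over to the unit ball. -/
lemma exists_modular_le_of_norm_le_one (hT : Tendsto T.modular (𝓝 0) (𝓝 0)) :
    ∃ B : ℝ, 0 ≤ B ∧ ∀ w : E, ‖w‖ ≤ 1 → T.modular w ≤ B := by
  obtain ⟨δ, hδ, h⟩ := Metric.eventually_nhds_iff.1 (hT.eventually (eventually_le_nhds one_pos))
  set t := min (δ / 2) 1 with ht
  have ht0 : 0 < t := by positivity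
  have ht1 : t ≤ 1 := min_le_right _ _
  have htb : 0 < t ^ T.upper := by positivity
  refine ⟨(t ^ T.upper)⁻¹, by positivity, fun w hw => ?_⟩
  have h1 : T.modular (t • w) ≤ 1 := by
    apply h
    rw [dist_zero_right, norm_smul, Real.norm_of_nonneg ht0.le]
    calc t * ‖w‖ ≤ t * 1 := by gcongr
      _ ≤ δ / 2 := by rw [mul_one]; exact min_le_left _ _
      _ < δ := by linarith
  have h2 := (T.le_modular_smul ht0 ht1 w).trans h1
  rwa [← one_div, le_div_iff₀' htb]

lemma exists_derivLinear_le (hT : Tendsto T.modular (𝓝 0) (𝓝 0)) (u : E) :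
    ∃ M : ℝ, ∀ w, ‖T.derivLinear u w‖ ≤ M * ‖w‖ := by
  obtain ⟨B, hB0, hB⟩ := T.exists_modular_le_of_norm_le_one hT
  obtain ⟨C, hC0, hC⟩ := T.exists_derivLinear_sub_le one_pos
  refine ⟨B + C * T.modular u, fun w => ?_⟩
  rcases eq_or_ne w 0 with rfl | hw
  · simp
  have hw' : 0 < ‖w‖ := norm_pos_iff.2 hw
  have h1 := hC 0 u (‖w‖⁻¹ • w)
  rw [zero_add, derivLinear_zero, sub_zero, T.modular_zero, zero_add, one_mul, map_smul,
    smul_eq_mul, abs_mul, abs_inv, abs_norm] at h1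
  have h2 := hB (‖w‖⁻¹ • w) (by simp [norm_smul, hw'.ne'])
  rw [Real.norm_eq_abs, ← inv_mul_le_iff₀' hw']
  linarith

/-- The derivative of the modular. -/
def deriv (hT : Tendsto T.modular (𝓝 0) (𝓝 0)) (u : E) : E →L[ℝ] ℝ :=
  (T.derivLinear u).mkContinuousOfExistsBound (T.exists_derivLinear_le hT u)

lemma deriv_apply (hT : Tendsto T.modular (𝓝 0) (𝓝 0)) (u v : E) :
    T.deriv hT u v = T.derivLinear u v := rfl

lemma tendsto_deriv_add (hT : Tendsto T.modular (𝓝 0) (𝓝 0)) (u : E) :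
    Tendsto (fun v => T.deriv hT (u + v)) (𝓝 0) (𝓝 (T.deriv hT u)) := by
  obtain ⟨B, hB0, hB⟩ := T.exists_modular_le_of_norm_le_one hT
  rw [Metric.tendsto_nhds]
  intro ε hε
  have hu := T.modular_nonneg u
  -- With this `η`, the term that does not vanish with `v` stays below `ε / 2` for all unit `w`;
  -- then `v` near `0` makes `C * T.modular v < ε / 2`.
  set η := ε / (2 * (T.modular u + B + 1)) with hη
  have hη0 : 0 < η := by positivity
  obtain ⟨C, hC0, hC⟩ := T.exists_derivLinear_sub_le hη0
  have h3 : ∀ᶠ v in 𝓝 (0 : E), T.modular v < ε / (2 * (C + 1)) :=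
    hT.eventually_lt_const (by positivity)
  filter_upwards [h3] with v hv
  rw [dist_eq_norm]
  have h4 : η * (T.modular u + B) + C * T.modular v < ε := by
    have e1 : η * (T.modular u + B) ≤ ε / 2 := by
      rw [hη, div_mul_eq_mul_div, div_le_div_iff₀ (by positivity) two_pos]
      nlinarith
    have e2 : C * T.modular v < ε / 2 := by
      have := T.modular_nonneg v
      have h5 : (C + 1) * T.modular v < ε / 2 := by
        rw [lt_div_iff₀ (by positivity)] at hv
        linarith
      linarith
    linarith
  refine lt_of_le_of_lt ?_ h4
  have hv0 := T.modular_nonneg v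
  refine ContinuousLinearMap.opNorm_le_of_unit_norm (by positivity) fun w hw => ?_
  rw [_root_.sub_apply, deriv_apply, deriv_apply, Real.norm_eq_abs]
  refine (hC u v w).trans ?_
  have := hB w hw.le
  gcongr

/-- Two tangent inequalities, at `u` and at `u + v`, sandwich the remainder: `0 ≤ ρ(u + v) - ρ(u) -
ρ'(u) v ≤ (ρ'(u + v) - ρ'(u)) v`. Continuity of `ρ'` then suffices. -/
lemma hasFDerivAt_modular (hT : Tendsto T.modular (𝓝 0) (𝓝 0)) (u : E) :
    HasFDerivAt T.modular (T.deriv hT u) u := by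
  rw [hasFDerivAt_iff_isLittleO_nhds_zero, Asymptotics.isLittleO_iff]
  intro ε hε
  filter_upwards [Metric.tendsto_nhds.1 (T.tendsto_deriv_add hT u) ε hε] with v hv
  rw [dist_eq_norm] at hv
  have h1 := T.modular_add_derivLinear_le u v
  have h2 := T.modular_add_derivLinear_le (u + v) (-v)
  rw [add_neg_cancel_right, map_neg] at h2
  have h3 := (T.deriv hT (u + v) - T.deriv hT u).le_opNorm v
  rw [_root_.sub_apply, deriv_apply, deriv_apply] at h3
  rw [deriv_apply, Real.norm_of_nonneg (by linarith)]
  have h4 := (le_abs_self _).trans h3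
  have h5 : ‖T.deriv hT (u + v) - T.deriv hT u‖ * ‖v‖ ≤ ε * ‖v‖ := by gcongr
  linarith

lemma contDiff_modular (hT : Tendsto T.modular (𝓝 0) (𝓝 0)) : ContDiff ℝ 1 T.modular := by
  rw [contDiff_one_iff_hasFDerivAt]
  refine ⟨T.deriv hT, continuous_iff_continuousAt.2 fun u => ?_, T.hasFDerivAt_modular hT⟩
  have h : Tendsto (fun x => x - u) (𝓝 u) (𝓝 0) := by
    have : Continuous fun x => x - u := by fun_prop
    simpa using this.tendsto u
  have := (T.tendsto_deriv_add hT u).comp h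
  simpa [Function.comp_def, ContinuousAt] using this

lemma modular_le_fderiv_self (hT : Tendsto T.modular (𝓝 0) (𝓝 0)) (u : E) :
    T.modular u ≤ fderiv ℝ T.modular u u := by
  rw [(T.hasFDerivAt_modular hT u).fderiv, deriv_apply]
  exact T.modular_le_derivLinear_self u

end Normed

end ModularMap

/-! ### The gauge of a modular -/

namespace ModularMap

variable {Z : Type*} [MeasurableSpace Z] {ν : Measure Z} {q : Z → ℝ}

section Algebraic

variable {E : Type*} [AddCommGroup E] [Module ℝ E]

/-- `g` is the Luxemburg gauge of the modular of `T`. -/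
structure IsGauge (T : ModularMap ν q E) (g : E → ℝ) : Prop where
  eq_of_modular_eq_one : ∀ u, ∀ l : ℝ, 0 < l → T.modular (l⁻¹ • u) = 1 → g u = l
  eq_zero_of_modular_eq_zero : ∀ u, T.modular u = 0 → g u = 0

variable (T : ModularMap ν q E)

lemma le_modular_smul_of_one_le {t : ℝ} (ht : 1 ≤ t) (u : E) :
    t * T.modular u ≤ T.modular (t • u) := by
  have ht0 : 0 < t := by linarith
  have := T.modular_smul_le (inv_nonneg.2 ht0.le) (inv_le_one_of_one_le₀ ht) (t • u)
  rwa [smul_smul, inv_mul_cancel₀ ht0.ne', one_smul, ← div_eq_inv_mul, le_div_iff₀' ht0] at this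

lemma modular_smul_le_of_one_le {t : ℝ} (ht : 1 ≤ t) (u : E) :
    T.modular (t • u) ≤ t ^ T.upper * T.modular u := by
  have ht0 : 0 < t := by linarith
  have := T.le_modular_smul (inv_pos.2 ht0) (inv_le_one_of_one_le₀ ht) (t • u)
  rwa [smul_smul, inv_mul_cancel₀ ht0.ne', one_smul, Real.inv_rpow ht0.le, ← div_eq_inv_mul,
    div_le_iff₀' (by positivity)] at this

lemma modular_smul_eq_zero {u : E} (hu : T.modular u = 0) {t : ℝ} (ht : 0 ≤ t) :
    T.modular (t • u) = 0 := by
  refine le_antisymm ?_ (T.modular_nonneg _)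
  rcases le_total t 1 with h | h
  · simpa [hu] using T.modular_smul_le ht h u
  · simpa [hu] using T.modular_smul_le_of_one_le h u

/-- The infimum defining the Luxemburg norm is the gauge, whether the inequality is strict
or not. -/
lemma isGauge_of_sInf {g : E → ℝ} {S : E → Set ℝ} (hg : ∀ u, g u = sInf (S u))
    (h1 : ∀ u l, 0 < l → T.modular (l⁻¹ • u) < 1 → l ∈ S u)
    (h2 : ∀ u, ∀ l ∈ S u, 0 < l ∧ T.modular (l⁻¹ • u) ≤ 1) : T.IsGauge g where
  eq_of_modular_eq_one u l hl h := by
    rw [hg]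
    refine csInf_eq_of_forall_ge_of_forall_gt_exists_lt ?_ ?_ ?_
    · refine ⟨2 * l, h1 u _ (by positivity) ?_⟩
      have := T.modular_smul_le (t := 2⁻¹) (by norm_num) (by norm_num) (l⁻¹ • u)
      rw [smul_smul, h, ← mul_inv] at this
      linarith
    · intro m hm
      obtain ⟨hm0, hm1⟩ := h2 u m hm
      by_contra! hlt
      have := T.le_modular_smul_of_one_le (t := m⁻¹ * l)
        (by rw [← div_eq_inv_mul, one_le_div hm0]; exact hlt.le) (l⁻¹ • u)
      rw [smul_smul, h, mul_one, mul_assoc, mul_inv_cancel₀ hl.ne', mul_one] at this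
      have h3 : 1 < m⁻¹ * l := by rw [← div_eq_inv_mul, one_lt_div hm0]; exact hlt
      linarith
    · intro m hm
      refine ⟨(l + m) / 2, h1 u _ (by linarith) ?_, by linarith⟩
      have hlm : 0 < (l + m) / 2 := by linarith
      have h3 : ((l + m) / 2)⁻¹ * l < 1 := by
        rw [← div_eq_inv_mul, div_lt_one hlm]; linarith
      have := T.modular_smul_le (t := ((l + m) / 2)⁻¹ * l) (by positivity) h3.le (l⁻¹ • u)
      rw [smul_smul, h, mul_one, mul_assoc, mul_inv_cancel₀ hl.ne', mul_one] at this
      linarith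
  eq_zero_of_modular_eq_zero u hu := by
    have : S u = Set.Ioi 0 := by
      ext l
      refine ⟨fun hl => (h2 u l hl).1, fun hl => h1 u l hl ?_⟩
      rw [T.modular_smul_eq_zero hu (inv_nonneg.2 (le_of_lt hl))]
      exact one_pos
    rw [hg, this, csInf_Ioi]

end Algebraic

/-! ### Norm properties and differentiability of the gauge -/

section Normed

variable {E : Type*} [NormedAddCommGroup E] [NormedSpace ℝ E] (T : ModularMap ν q E)

/-- Intermediate values along the ray through `u`, up to `t = 1 + m⁻¹` with `m = T.modular u`: since
`t ≥ 1`, the modular of `t • u` is at least `t * m = m + 1`. -/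
lemma exists_modular_inv_smul_eq_one (hc : Continuous T.modular) {u : E}
    (hu : T.modular u ≠ 0) : ∃ l : ℝ, 0 < l ∧ T.modular (l⁻¹ • u) = 1 := by
  have hpos : 0 < T.modular u := lt_of_le_of_ne (T.modular_nonneg u) hu.symm
  set m := T.modular u with hm
  have h0 : T.modular ((0 : ℝ) • u) ≤ 1 := by rw [zero_smul, T.modular_zero]; exact zero_le_one
  have h1 : 1 ≤ T.modular ((1 + m⁻¹) • u) := by
    have h2 : 1 ≤ 1 + m⁻¹ := by have := inv_pos.2 hpos; linarith
    refine le_trans ?_ (T.le_modular_smul_of_one_le h2 u)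
    rw [← hm, add_mul, inv_mul_cancel₀ hpos.ne']
    linarith
  obtain ⟨t, ht, h⟩ := intermediate_value_Icc (f := fun t : ℝ => T.modular (t • u))
    (by positivity : (0 : ℝ) ≤ 1 + m⁻¹) (by fun_prop) ⟨h0, h1⟩
  have ht0 : t ≠ 0 := by
    rintro rfl
    simp [T.modular_zero] at h
  have : 0 < t := lt_of_le_of_ne ht.1 ht0.symm
  exact ⟨t⁻¹, inv_pos.2 this, by simpa using h⟩

namespace IsGauge

variable {T} {g : E → ℝ}

lemma modular_inv_smul (hg : T.IsGauge g) (hc : Continuous T.modular) {u : E} (hu : g u ≠ 0) :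
    0 < g u ∧ T.modular ((g u)⁻¹ • u) = 1 := by
  obtain ⟨l, hl, h⟩ := T.exists_modular_inv_smul_eq_one hc
    (fun h => hu (hg.eq_zero_of_modular_eq_zero u h))
  rw [hg.eq_of_modular_eq_one u l hl h]
  exact ⟨hl, h⟩

lemma nonneg (hg : T.IsGauge g) (hc : Continuous T.modular) (u : E) : 0 ≤ g u := by
  by_cases hu : g u = 0
  · exact hu.ge
  · exact (hg.modular_inv_smul hc hu).1.le

lemma modular_eq_zero (hg : T.IsGauge g) (hc : Continuous T.modular) {u : E} (hu : g u = 0) :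
    T.modular u = 0 := by
  by_contra h
  obtain ⟨l, hl, h⟩ := T.exists_modular_inv_smul_eq_one hc h
  exact hl.ne' ((hg.eq_of_modular_eq_one u l hl h).symm.trans hu)

lemma modular_smul_inv_smul {u : E} (h : g u ≠ 0) : T.modular (g u • (g u)⁻¹ • u) = T.modular u := by
  rw [smul_smul, mul_inv_cancel₀ h, one_smul]

/-- Together with `rpow_le_modular` this gives `g ^ upper ≤ ρ ≤ g` for `0 < g ≤ 1`, so that
smallness of the gauge and smallness of the modular are equivalent. -/
lemma modular_le (hg : T.IsGauge g) (hc : Continuous T.modular) {u : E} (hu : g u ≤ 1) :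
    T.modular u ≤ g u := by
  by_cases h : g u = 0
  · rw [hg.modular_eq_zero hc h, h]
  · obtain ⟨h0, h1⟩ := hg.modular_inv_smul hc h
    have := T.modular_smul_le h0.le hu ((g u)⁻¹ • u)
    rwa [modular_smul_inv_smul h, h1, mul_one] at this

lemma rpow_le_modular (hg : T.IsGauge g) (hc : Continuous T.modular) {u : E} (hu : g u ≤ 1)
    (h : g u ≠ 0) : g u ^ T.upper ≤ T.modular u := by
  obtain ⟨h0, h1⟩ := hg.modular_inv_smul hc h
  have := T.le_modular_smul h0 hu ((g u)⁻¹ • u)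
  rwa [modular_smul_inv_smul h, h1, mul_one] at this

lemma le_one_of_modular_le (hg : T.IsGauge g) (hc : Continuous T.modular) {u : E}
    (hu : T.modular u ≤ 1) : g u ≤ 1 := by
  by_contra! hlt
  have h : g u ≠ 0 := by linarith
  obtain ⟨h0, h1⟩ := hg.modular_inv_smul hc h
  have := T.le_modular_smul_of_one_le hlt.le ((g u)⁻¹ • u)
  rw [modular_smul_inv_smul h, h1, mul_one] at this
  linarith

lemma smul_of_pos (hg : T.IsGauge g) (hc : Continuous T.modular) {t : ℝ} (ht : 0 < t) (u : E) :
    g (t • u) = t * g u := by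
  by_cases h : g u = 0
  · rw [h, mul_zero]
    exact hg.eq_zero_of_modular_eq_zero _ (T.modular_smul_eq_zero (hg.modular_eq_zero hc h) ht.le)
  · obtain ⟨h0, h1⟩ := hg.modular_inv_smul hc h
    refine hg.eq_of_modular_eq_one _ _ (by positivity) ?_
    rw [smul_smul, mul_inv, mul_right_comm, inv_mul_cancel₀ ht.ne', one_mul, h1]

lemma neg (hg : T.IsGauge g) (hc : Continuous T.modular) (u : E) : g (-u) = g u := by
  have hm : ∀ v : E, T.modular (-v) = T.modular v := fun v => by
    rw [← neg_one_smul ℝ v, T.modular_smul]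
    simp only [neg_mul, one_mul, abs_neg]
    rfl
  by_cases h : g u = 0
  · rw [h]
    exact hg.eq_zero_of_modular_eq_zero _ ((hm u).trans (hg.modular_eq_zero hc h))
  · obtain ⟨h0, h1⟩ := hg.modular_inv_smul hc h
    refine hg.eq_of_modular_eq_one _ _ h0 ?_
    rw [smul_neg, hm, h1]

lemma smul (hg : T.IsGauge g) (hc : Continuous T.modular) (t : ℝ) (u : E) :
    g (t • u) = |t| * g u := by
  rcases lt_trichotomy t 0 with ht | rfl | ht
  · rw [← hg.neg hc, ← neg_smul, hg.smul_of_pos hc (neg_pos.2 ht), abs_of_neg ht]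
  · rw [zero_smul, abs_zero, zero_mul]
    exact hg.eq_zero_of_modular_eq_zero _ T.modular_zero
  · rw [hg.smul_of_pos hc ht, abs_of_pos ht]

lemma le_iff (hg : T.IsGauge g) (hc : Continuous T.modular) {l : ℝ} (hl : 0 < l) (u : E) :
    g u ≤ l ↔ T.modular (l⁻¹ • u) ≤ 1 := by
  have h1 : g u ≤ l ↔ g (l⁻¹ • u) ≤ 1 := by
    rw [hg.smul_of_pos hc (inv_pos.2 hl), ← div_eq_inv_mul, div_le_one hl]
  rw [h1]
  exact ⟨fun h => (hg.modular_le hc h).trans h, hg.le_one_of_modular_le hc⟩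

lemma add_le (hg : T.IsGauge g) (hc : Continuous T.modular) (u v : E) :
    g (u + v) ≤ g u + g v := by
  have hu := hg.nonneg hc u
  have hv := hg.nonneg hc v
  refine le_of_forall_pos_le_add fun ε hε => ?_
  have hl : 0 < g u + ε / 2 := by positivity
  have hm : 0 < g v + ε / 2 := by positivity
  have h1 := (hg.le_iff hc hl u).1 (by linarith)
  have h2 := (hg.le_iff hc hm v).1 (by linarith)
  rw [show g u + g v + ε = (g u + ε / 2) + (g v + ε / 2) by ring]
  set l := g u + ε / 2
  set m := g v + ε / 2
  rw [hg.le_iff hc (by positivity)]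
  have h3 := T.modular_convex_comb_le (l⁻¹ • u) (m⁻¹ • v) (s := l / (l + m)) (t := m / (l + m))
    (by positivity) (by positivity) (by field_simp)
  have e : (l / (l + m)) • l⁻¹ • u + (m / (l + m)) • m⁻¹ • v = (l + m)⁻¹ • (u + v) := by
    rw [smul_smul, smul_smul, smul_add]
    congr 2 <;> field_simp
  rw [e] at h3
  refine h3.trans ?_
  calc _ ≤ l / (l + m) * 1 + m / (l + m) * 1 := by gcongr
    _ = 1 := by field_simp

lemma le_of_modular_le_rpow (hg : T.IsGauge g) (hc : Continuous T.modular)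
    (hb : 0 < T.upper) {u : E} {l : ℝ} (hl0 : 0 ≤ l) (hl1 : l ≤ 1)
    (h : T.modular u ≤ l ^ T.upper) : g u ≤ l := by
  by_cases h0 : g u = 0
  · rwa [h0]
  have h1 := hg.le_one_of_modular_le hc (h.trans (Real.rpow_le_one hl0 hl1 hb.le))
  have h2 := (hg.rpow_le_modular hc h1 h0).trans h
  exact (Real.rpow_le_rpow_iff (hg.nonneg hc u) hl0 hb).1 h2

/-- The gauge is `C¹` away from its zeros. -/
lemma contDiffAt [CompleteSpace E] (hg : T.IsGauge g) (hT : Tendsto T.modular (𝓝 0) (𝓝 0))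
    {u : E} (hu : g u ≠ 0) : ContDiffAt ℝ 1 g u := by
  have hC1 := T.contDiff_modular hT
  have hc := hC1.continuous
  obtain ⟨h0, h1⟩ := hg.modular_inv_smul hc hu
  -- The equation `F (x, t) = 1` is solved by `t = (g x)⁻¹`, so the implicit function is the inverse
  -- of the gauge.
  set F : E × ℝ → ℝ := fun x => T.modular (x.2 • x.1) with hF
  have hFC : ContDiff ℝ 1 F := hC1.comp (contDiff_snd.smul contDiff_fst)
  set x₀ : E × ℝ := (u, (g u)⁻¹) with hx₀
  have hF1 : F x₀ = 1 := h1
  have hderiv : fderiv ℝ F x₀ (0, 1) = fderiv ℝ T.modular ((g u)⁻¹ • u) u := by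
    have e0 : HasFDerivAt T.modular (fderiv ℝ T.modular ((g u)⁻¹ • u)) (x₀.2 • x₀.1) :=
      (hC1.differentiable one_ne_zero ((g u)⁻¹ • u)).hasFDerivAt
    have e1 := e0.comp x₀
      ((hasFDerivAt_snd (𝕜 := ℝ) (p := x₀)).smul (hasFDerivAt_fst (𝕜 := ℝ) (p := x₀)))
    change fderiv ℝ (T.modular ∘ ((Prod.snd : E × ℝ → ℝ) • (Prod.fst : E × ℝ → E))) x₀ (0, 1) = _
    rw [e1.fderiv]
    simp [hx₀]
  -- If it vanished, so would the derivative of the modular at `(g u)⁻¹ • u` in its own direction,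
  -- which is at least the modular there, namely `1`.
  have hne : fderiv ℝ F x₀ (0, 1) ≠ 0 := by
    rw [hderiv]
    intro h
    have := T.modular_le_fderiv_self hT ((g u)⁻¹ • u)
    rw [h1, map_smul, h, smul_zero] at this
    linarith
  have hinv : (fderiv ℝ F x₀ ∘L .inr ℝ E ℝ).IsInvertible := by
    refine ⟨ContinuousLinearEquiv.unitsEquivAut ℝ (Units.mk0 _ hne), ?_⟩
    ext
    simp
  have hcd : ContDiffAt ℝ 1 F x₀ := hFC.contDiffAt
  set ψ := hcd.implicitFunction one_ne_zero hinv with hψ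
  have hψC : ContDiffAt ℝ 1 ψ u := hcd.contDiffAt_implicitFunction one_ne_zero hinv
  have hψ0 : ψ u = (g u)⁻¹ := hcd.implicitFunction_apply_self one_ne_zero hinv
  have hev : ∀ᶠ x in 𝓝 u, F (x, ψ x) = F x₀ :=
    hcd.eventually_apply_implicitFunction one_ne_zero hinv
  have hpos : ∀ᶠ x in 𝓝 u, 0 < ψ x :=
    hψC.continuousAt.eventually (lt_mem_nhds (by rw [hψ0]; exact inv_pos.2 h0))
  refine (hψC.inv (by rw [hψ0]; exact inv_ne_zero hu)).congr_of_eventuallyEq ?_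
  filter_upwards [hev, hpos] with x hx hx0
  refine hg.eq_of_modular_eq_one x _ (inv_pos.2 hx0) ?_
  rw [Pi.inv_apply, inv_inv, ← hF1, ← hx]

/-- By subadditivity the right difference quotients of `g` at `u` in direction `w` are at most `g
w`; applying this to `v` and `-v` gives both signs. -/
lemma abs_fderiv_le (hg : T.IsGauge g) (hc : Continuous T.modular) {u : E}
    (hd : DifferentiableAt ℝ g u) (v : E) : |fderiv ℝ g u v| ≤ g v := by
  have key : ∀ w, fderiv ℝ g u w ≤ g w := by
    intro w
    have h1 : HasDerivAt (fun t : ℝ => g (u + t • w)) (fderiv ℝ g u w) 0 := by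
      have := (hd.hasFDerivAt.hasLineDerivAt w)
      exact this
    have h2 : Tendsto (fun t : ℝ => t⁻¹ • (g (u + (0 + t) • w) - g (u + (0 : ℝ) • w))) (𝓝[>] 0)
        (𝓝 (fderiv ℝ g u w)) :=
      (hasDerivAt_iff_tendsto_slope_zero.1 h1).mono_left
        (nhdsWithin_mono (0 : ℝ) (fun t (ht : 0 < t) => ht.ne'))
    refine le_of_tendsto h2 ?_
    filter_upwards [self_mem_nhdsWithin] with t (ht : 0 < t)
    have := hg.add_le hc u (t • w)
    rw [hg.smul_of_pos hc ht] at this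
    simp only [zero_add, zero_smul, add_zero, smul_eq_mul]
    rw [inv_mul_le_iff₀ ht]
    linarith
  refine abs_le.2 ⟨?_, key v⟩
  have := key (-v)
  rw [map_neg, hg.neg hc] at this
  linarith

/-- Euler's identity: by homogeneity, `g` is affine along the ray `u + t • u` for `t > -1`. -/
lemma fderiv_self (hg : T.IsGauge g) (hc : Continuous T.modular) {u : E}
    (hd : DifferentiableAt ℝ g u) : fderiv ℝ g u u = g u := by
  have h1 : HasDerivAt (fun t : ℝ => g (u + t • u)) (fderiv ℝ g u u) 0 :=
    hd.hasFDerivAt.hasLineDerivAt u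
  have h2 : HasDerivAt (fun t : ℝ => (1 + t) * g u) (g u) 0 := by
    simpa using ((hasDerivAt_id (0 : ℝ)).const_add 1).mul_const (g u)
  refine h1.unique (h2.congr_of_eventuallyEq ?_)
  filter_upwards [lt_mem_nhds (show (-1 : ℝ) < 0 by norm_num)] with t ht
  rw [← hg.smul_of_pos hc (by linarith), add_smul, one_smul]

end IsGauge

end Normed

end ModularMap

/-! ### The Palais–Smale condition for gauges -/

namespace ModularMap

variable {Z : Type*} [MeasurableSpace Z] {ν : Measure Z} {q : Z → ℝ}
variable {E : Type*} [NormedAddCommGroup E] [NormedSpace ℝ E] {T : ModularMap ν q E} {g : E → ℝ}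

lemma upper_pos (T : ModularMap ν q E) (z : Z) : 0 < T.upper :=
  (one_pos.trans (T.one_lt_exponent z)).trans_le (T.mem_Icc z).2

lemma IsGauge.tendsto_zero (hg : T.IsGauge g) (hc : Continuous T.modular) (hb : 0 < T.upper)
    {α : Type*} {l : Filter α} {f : α → E} (h : Tendsto (fun x => T.modular (f x)) l (𝓝 0)) :
    Tendsto (fun x => g (f x)) l (𝓝 0) := by
  rw [Metric.tendsto_nhds]
  intro ε hε
  set δ := min (ε / 2) 1 with hδ
  have hδ0 : 0 < δ := by positivity
  have hδ1 : δ < ε := (min_le_left _ _).trans_lt (by linarith)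
  have hp : 0 < δ ^ T.upper := by positivity
  filter_upwards [h.eventually_lt_const hp] with x hx
  rw [dist_zero_right, Real.norm_of_nonneg (hg.nonneg hc _)]
  exact (hg.le_of_modular_le_rpow hc hb hδ0.le (min_le_right _ _) hx.le).trans_lt hδ1

/-- Where the modular is at most `B`, dividing by `1 + B` brings it below `1`. The bound makes `g`
Lipschitz and keeps the norm away from `0` on `{g = 1}`. -/
lemma IsGauge.exists_le_mul_norm (hg : T.IsGauge g) (hT : Tendsto T.modular (𝓝 0) (𝓝 0)) :
    ∃ C : ℝ, 0 < C ∧ ∀ u, g u ≤ C * ‖u‖ := by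
  have hc := (T.contDiff_modular hT).continuous
  obtain ⟨B, hB0, hB⟩ := T.exists_modular_le_of_norm_le_one hT
  refine ⟨1 + B, by positivity, fun u => ?_⟩
  rcases eq_or_ne u 0 with rfl | hu
  · simp [hg.eq_zero_of_modular_eq_zero 0 T.modular_zero]
  have hu' : 0 < ‖u‖ := norm_pos_iff.2 hu
  have h1 := hB (‖u‖⁻¹ • u) (by simp [norm_smul, hu'.ne'])
  have h2 : g (‖u‖⁻¹ • u) ≤ 1 + B := by
    rw [hg.le_iff hc (by positivity)]
    refine (T.modular_smul_le (by positivity) (inv_le_one_of_one_le₀ (by linarith)) _).trans ?_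
    rw [inv_mul_le_iff₀ (by positivity)]
    linarith
  rwa [hg.smul_of_pos hc (inv_pos.2 hu'), inv_mul_le_iff₀ hu', mul_comm] at h2

lemma IsGauge.continuous (hg : T.IsGauge g) (hT : Tendsto T.modular (𝓝 0) (𝓝 0)) :
    Continuous g := by
  have hc := (T.contDiff_modular hT).continuous
  obtain ⟨C, hC0, hC⟩ := hg.exists_le_mul_norm hT
  refine (LipschitzWith.of_le_add_mul (Real.toNNReal C) fun u v => ?_).continuous
  have := hg.add_le hc v (u - v)
  rw [add_sub_cancel] at this
  rw [Real.coe_toNNReal _ hC0.le, dist_eq_norm]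
  linarith [hC (u - v)]

/-- Uniform convexity in sequential form: if the midpoints of unit vectors have norms tending to
`1`, the vectors get close to each other. -/
lemma IsGauge.tendsto_sub_of_tendsto_midpoint (hg : T.IsGauge g) (hc : Continuous T.modular)
    (hb : 0 < T.upper) {α : Type*} {l : Filter α} {f h : α → E} (hf : ∀ x, g (f x) = 1)
    (hh : ∀ x, g (h x) = 1)
    (hm : Tendsto (fun x => g ((1 / 2 : ℝ) • (f x + h x))) l (𝓝 1)) :
    Tendsto (fun x => g (f x - h x)) l (𝓝 0) := by
  refine hg.tendsto_zero hc hb ?_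
  have hmod : ∀ u, g u = 1 → T.modular u = 1 := fun u hu => by
    have := (hg.modular_inv_smul hc (u := u) (by rw [hu]; exact one_ne_zero)).2
    rwa [hu, inv_one, one_smul] at this
  have hpow : Tendsto (fun x => g ((1 / 2 : ℝ) • (f x + h x)) ^ T.upper) l (𝓝 1) := by
    simpa using hm.rpow_const (p := T.upper) (Or.inl one_ne_zero)
  have hle : ∀ x, g ((1 / 2 : ℝ) • (f x + h x)) ≤ 1 := fun x => by
    rw [hg.smul_of_pos hc (by norm_num)]
    have := hg.add_le hc (f x) (h x)
    rw [hf, hh] at this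
    linarith
  rw [Metric.tendsto_nhds]
  intro ε hε
  -- Both modulars equal `1`, so the first term is `ε / 2`. The convexity defect `1 - ρ(midpoint)`
  -- is at most `1 - g(midpoint) ^ upper`, which tends to `0` and accounts for the other half.
  obtain ⟨C, hC0, hC⟩ := T.exists_modular_sub_le (show 0 < ε / 4 by positivity)
  have h1 : 1 - ε / (2 * (C + 1)) < 1 := by
    have : 0 < ε / (2 * (C + 1)) := by positivity
    linarith
  filter_upwards [hpow.eventually_const_lt h1, hm.eventually_const_lt one_pos] with x hx hx0
  rw [dist_zero_right, Real.norm_of_nonneg (T.modular_nonneg _)]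
  refine (hC (f x) (h x)).trans_lt ?_
  rw [hmod _ (hf x), hmod _ (hh x)]
  have h2 := hg.rpow_le_modular hc (hle x) hx0.ne'
  have h3 : (1 + 1) / 2 - T.modular ((1 / 2 : ℝ) • (f x + h x)) < ε / (2 * (C + 1)) := by
    linarith
  rw [lt_div_iff₀ (by positivity)] at h3
  have h4 : T.modular ((1 / 2 : ℝ) • (f x + h x)) ≤ 1 := by
    exact (hg.modular_le hc (hle x)).trans (hle x)
  nlinarith

end ModularMap

section Abstract

variable {Z Y : Type*} [MeasurableSpace Z] [MeasurableSpace Y] {ν : Measure Z} {μ : Measure Y}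
  {q : Z → ℝ} {r : Y → ℝ}
variable {E : Type*} [NormedAddCommGroup E] [NormedSpace ℝ E]

/-- The derivative of `F` in a direction `d`, when the restriction of `F'(u)` to the tangent
space at `u` of a level set of the gauge `g` is small. -/
lemma abs_fderiv_le_of_tangentialDeriv {S : ModularMap μ r E} {F g : E → ℝ} (hg : S.IsGauge g)
    (hc : Continuous S.modular) {u : E} (hu : g u = 1) (hd : DifferentiableAt ℝ g u) (d : E) :
    |fderiv ℝ F u d| ≤
      g d * |fderiv ℝ F u u| + ‖tangentialDeriv F g u‖ * (‖d‖ + g d * ‖u‖) := by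
  -- As `g'(u) u = g u = 1`, the vector `d - κ • u` is the projection of `d` onto `ker g'(u)` along
  -- `u`.
  set κ := fderiv ℝ g u d with hκ
  have hκ' : |κ| ≤ g d := hg.abs_fderiv_le hc hd d
  have hz : d - κ • u ∈ (fderiv ℝ g u).ker := by
    rw [LinearMap.mem_ker]
    change fderiv ℝ g u (d - κ • u) = 0
    rw [map_sub, map_smul, hg.fderiv_self hc hd, hu]
    simp [hκ]
  have h1 : |fderiv ℝ F u (d - κ • u)| ≤ ‖tangentialDeriv F g u‖ * ‖d - κ • u‖ :=
    (tangentialDeriv F g u).le_opNorm ⟨_, hz⟩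
  have h2 : ‖d - κ • u‖ ≤ ‖d‖ + g d * ‖u‖ := by
    refine (norm_sub_le _ _).trans ?_
    rw [norm_smul, Real.norm_eq_abs]
    gcongr
  have h3 : fderiv ℝ F u d = κ * fderiv ℝ F u u + fderiv ℝ F u (d - κ • u) := by
    rw [map_sub, map_smul, smul_eq_mul]; ring
  rw [h3]
  refine (abs_add_le _ _).trans ?_
  rw [abs_mul]
  have h4 := h1.trans (mul_le_mul_of_nonneg_left h2 (ContinuousLinearMap.opNorm_nonneg _))
  gcongr

/-- Compactness is assumed in Cauchy form, for differences along a subsequence, so no limit in a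
Lebesgue space is needed; the limit is produced by the completeness of `E`. -/
theorem palaisSmale_of_isGauge [CompleteSpace E] {T : ModularMap ν q E} {S : ModularMap μ r E} {F g : E → ℝ}
    (hF : T.IsGauge F) (hT : Tendsto T.modular (𝓝 0) (𝓝 0)) (hTb : 0 < T.upper)
    (hFn : ∀ u, ‖u‖ = F u)
    (hg : S.IsGauge g) (hS : Tendsto S.modular (𝓝 0) (𝓝 0)) (hSb : 0 < S.upper)
    (hcompact : ∀ (u : ℕ → E) (R : ℝ), (∀ n, ‖u n‖ ≤ R) → ∃ φ : ℕ → ℕ, StrictMono φ ∧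
      Tendsto (fun x : ℕ × ℕ => S.modular (u (φ x.1) - u (φ x.2))) atTop (𝓝 0)) :
    PalaisSmale F g := by
  intro c u hu1 huc hut
  have hTc := (T.contDiff_modular hT).continuous
  have hSc := (S.contDiff_modular hS).continuous
  obtain ⟨C, hC0, hC⟩ := hg.exists_le_mul_norm hS
  have hlow : ∀ n, C⁻¹ ≤ F (u n) := fun n => by
    have := hC (u n)
    rw [hu1, hFn] at this
    rwa [← one_div, div_le_iff₀' hC0]
  -- The constraint `g = 1` bounds `F` below by `C⁻¹`, so the normalisation by `F (w n)` below stays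
  -- under control.
  have hcpos : 0 < c := (inv_pos.2 hC0).trans_le (ge_of_tendsto' huc hlow)
  obtain ⟨R, hR⟩ := huc.bddAbove_range
  have hR' : ∀ n, F (u n) ≤ R := fun n => hR ⟨n, rfl⟩
  obtain ⟨φ, hφ, hφS⟩ := hcompact u R fun n => (hFn _).trans_le (hR' n)
  have hφg := hg.tendsto_zero hSc hSb hφS
  set w : ℕ → E := fun n => u (φ n) with hw
  have hFpos : ∀ n, 0 < F (w n) := fun n => (inv_pos.2 hC0).trans_le (hlow _)
  have hR0 : 0 ≤ R := (hFpos 0).le.trans (hR' _)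
  have hFd : ∀ n, DifferentiableAt ℝ F (w n) := fun n =>
    (hF.contDiffAt hT (hFpos n).ne').differentiableAt one_ne_zero
  have hgd : ∀ n, DifferentiableAt ℝ g (w n) := fun n =>
    (hg.contDiffAt hS (by rw [hu1]; exact one_ne_zero)).differentiableAt one_ne_zero
  have hfst : Tendsto (fun x : ℕ × ℕ => x.1) atTop atTop := by
    rw [← prod_atTop_atTop_eq]; exact tendsto_fst
  have hsnd : Tendsto (fun x : ℕ × ℕ => x.2) atTop atTop := by
    rw [← prod_atTop_atTop_eq]; exact tendsto_snd
  have hwc : Tendsto (fun n => F (w n)) atTop (𝓝 c) := huc.comp hφ.tendsto_atTop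
  have hwt : Tendsto (fun n => ‖tangentialDeriv F g (w n)‖) atTop (𝓝 0) :=
    hut.comp hφ.tendsto_atTop
  have hA : Tendsto (fun x : ℕ × ℕ => fderiv ℝ F (w x.1) (w x.1 - w x.2)) atTop (𝓝 0) := by
    refine squeeze_zero_norm (a := fun x : ℕ × ℕ => g (w x.1 - w x.2) * R +
      ‖tangentialDeriv F g (w x.1)‖ * (2 * R + g (w x.1 - w x.2) * R)) (fun x => ?_) ?_
    · have h1 := abs_fderiv_le_of_tangentialDeriv (F := F) hg hSc (hu1 (φ x.1)) (hgd x.1)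
        (w x.1 - w x.2)
      refine h1.trans ?_
      have h2 : |fderiv ℝ F (w x.1) (w x.1)| ≤ R := by
        rw [hF.fderiv_self hTc (hFd x.1), abs_of_pos (hFpos _)]
        exact hR' _
      have h3 : ‖w x.1‖ ≤ R := (hFn _).trans_le (hR' _)
      have h4 : ‖w x.1 - w x.2‖ ≤ 2 * R := by
        refine (norm_sub_le _ _).trans ?_
        have : ‖w x.2‖ ≤ R := (hFn _).trans_le (hR' _)
        linarith
      have h5 := hg.nonneg hSc (w x.1 - w x.2)
      gcongr
    · have h1 := (hφg.mul_const R).add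
        ((hwt.comp hfst).mul ((hφg.mul_const R).const_add (2 * R)))
      simpa using h1
  set f : ℕ → E := fun n => (F (w n))⁻¹ • w n with hf
  have hf1 : ∀ n, F (f n) = 1 := fun n => by
    rw [hf, hF.smul_of_pos hTc (inv_pos.2 (hFpos n)), inv_mul_cancel₀ (hFpos n).ne']
  -- The lower bound is the value of the functional `F'(w x.1)`, which is dominated by `F`, at the
  -- midpoint; the upper bound is the triangle inequality.
  have hmid : Tendsto (fun x : ℕ × ℕ => F ((1 / 2 : ℝ) • (f x.1 + f x.2))) atTop (𝓝 1) := by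
    have hlim : Tendsto (fun x : ℕ × ℕ => 1 / 2 * (1 + (F (w x.2))⁻¹ *
        (F (w x.1) - fderiv ℝ F (w x.1) (w x.1 - w x.2)))) atTop (𝓝 1) := by
      have h1 := (((hwc.comp hsnd).inv₀ hcpos.ne').mul ((hwc.comp hfst).sub hA)).const_add 1
        |>.const_mul (1 / 2)
      rw [sub_zero, inv_mul_cancel₀ hcpos.ne'] at h1
      norm_num at h1
      simpa using h1
    refine tendsto_of_tendsto_of_tendsto_of_le_of_le hlim tendsto_const_nhds
      (fun x => ?_) (fun x => ?_)
    · have h1 := (le_abs_self _).trans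
        (hF.abs_fderiv_le hTc (hFd x.1) ((1 / 2 : ℝ) • (f x.1 + f x.2)))
      refine le_trans (le_of_eq ?_) h1
      simp only [hf, map_smul, map_add, map_sub, smul_eq_mul, hF.fderiv_self hTc (hFd x.1)]
      rw [inv_mul_cancel₀ (hFpos _).ne']
      ring
    · have := hF.add_le hTc (f x.1) (f x.2)
      rw [hf1, hf1] at this
      simp only
      rw [hF.smul_of_pos hTc (by norm_num)]
      linarith
  have hcauchy : CauchySeq f := by
    rw [cauchySeq_iff_tendsto_dist_atTop_0]
    simp only [dist_eq_norm, hFn]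
    exact hF.tendsto_sub_of_tendsto_midpoint hTc hTb (f := fun x : ℕ × ℕ => f x.1)
      (h := fun x : ℕ × ℕ => f x.2) (fun x => hf1 _) (fun x => hf1 _) hmid
  obtain ⟨v, hv⟩ := cauchySeq_tendsto_of_complete hcauchy
  have hlim : Tendsto w atTop (𝓝 (c • v)) := by
    refine (hwc.smul hv).congr fun n => ?_
    rw [hf, smul_smul, mul_inv_cancel₀ (hFpos n).ne', one_smul]
  refine ⟨φ, hφ, c • v, ?_, hlim⟩
  have h1 := ((hg.continuous hS).tendsto _).comp hlim
  refine tendsto_nhds_unique h1 (tendsto_const_nhds.congr fun n => ?_)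
  exact (hu1 _).symm

end Abstract

variable {N : ℕ} {s : ℝ}

/-! ### The embedding into the variable exponent Lebesgue space -/

/-- The Gagliardo energy at a point. -/
def pointEnergy (p : AdmissibleExponent N s) (f : Space N → ℝ) (x : Space N) : ℝ≥0∞ :=
  ∫⁻ y, ENNReal.ofReal (|f x - f y| ^ p x y * p.weight (x, y))

lemma measurable_energy_integrand (p : AdmissibleExponent N s) {f : Space N → ℝ}
    (hf : Measurable f) : Measurable fun z : Space N × Space N =>
      ENNReal.ofReal (|f z.1 - f z.2| ^ p z.1 z.2 * p.weight z) := by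
  have := p.measurable
  have := p.weight_measurable
  fun_prop

lemma measurable_pointEnergy (p : AdmissibleExponent N s) {f : Space N → ℝ} (hf : Measurable f) :
    Measurable (pointEnergy p f) :=
  (measurable_energy_integrand p hf).lintegral_prod_right'

lemma lintegral_pointEnergy (p : AdmissibleExponent N s) {f : Space N → ℝ} (hf : Measurable f) :
    ∫⁻ x, pointEnergy p f x = gagliardoEnergy p f := by
  rw [gagliardoEnergy_eq, Measure.volume_eq_prod,
    lintegral_prod _ (measurable_energy_integrand p hf).aemeasurable]
  rfl

/-- The volume of the unit ball. -/
def unitBallVolume (N : ℕ) : ℝ := (volume (Metric.ball (0 : Space N) 1)).toReal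

lemma unitBallVolume_pos (N : ℕ) : 0 < unitBallVolume N :=
  ENNReal.toReal_pos (Metric.measure_ball_pos volume _ one_pos).ne' measure_ball_lt_top.ne

lemma volume_ball_eq (x : Space N) {r : ℝ} (hr : 0 < r) :
    volume (Metric.ball x r) = ENNReal.ofReal (unitBallVolume N * r ^ N) := by
  rw [Measure.addHaar_ball_of_pos volume x hr, finrank_euclideanSpace_fin, mul_comm (unitBallVolume N),
    ENNReal.ofReal_mul (by positivity), unitBallVolume,
    ENNReal.ofReal_toReal measure_ball_lt_top.ne]

/-- Truncation at level `T`: if `D > T ≥ 1`, then `D = D ^ m * D ^ (1 - m) ≤ D ^ q * T ^ (1 - m)`.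
The level is optimised in `abs_rpow_le_energy`. -/
lemma le_add_rpow_mul {D T m q : ℝ} (hD : 0 ≤ D) (hT : 1 ≤ T) (hm : 1 ≤ m) (hq : m ≤ q) :
    D ≤ T + D ^ q * T ^ (1 - m) := by
  have hT0 : 0 < T := by linarith
  rcases le_or_gt D T with h | h
  · have : 0 ≤ D ^ q * T ^ (1 - m) := by positivity
    linarith
  · have hD0 : 0 < D := hT0.trans h
    have h1 : D ^ (1 - m) ≤ T ^ (1 - m) :=
      Real.rpow_le_rpow_of_nonpos hT0 h.le (by linarith)
    have h2 : D ^ m ≤ D ^ q := Real.rpow_le_rpow_of_exponent_le (by linarith) hq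
    have h3 : D = D ^ m * D ^ (1 - m) := by
      rw [← Real.rpow_add hD0]; norm_num
    have h4 : D ^ m * D ^ (1 - m) ≤ D ^ q * T ^ (1 - m) := by gcongr
    linarith

/-- A pointwise bound of differences by the integrand of the Gagliardo energy. -/
lemma abs_sub_le_energy (hs0 : 0 < s) (p : AdmissibleExponent N s) (f : Space N → ℝ)
    {x y : Space N} {r T m : ℝ} (hT : 1 ≤ T) (hm : 1 ≤ m) (hxy : ‖x - y‖ ≤ r)
    (hp : m ≤ p x y) :
    |f x - f y| ≤ r ^ s * (T + T ^ (1 - m) * r ^ N * (|f x - f y| ^ p x y * p.weight (x, y))) := by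
  have hr : 0 ≤ r := (norm_nonneg _).trans hxy
  have hw := p.weight_nonneg (x, y)
  rcases eq_or_ne x y with rfl | hne
  · rw [sub_self, abs_zero]
    positivity
  set d := ‖x - y‖ with hd
  have hd0 : 0 < d := norm_pos_iff.2 (sub_ne_zero.2 hne)
  -- The power `p x y` of the Hölder quotient is `d ^ N` times the Gagliardo integrand.
  have h1 := le_add_rpow_mul (D := |f x - f y| / d ^ s) (by positivity) hT hm hp
  have h2 : (|f x - f y| / d ^ s) ^ p x y = d ^ N * (|f x - f y| ^ p x y * p.weight (x, y)) := by
    rw [Real.div_rpow (abs_nonneg _) (by positivity), ← Real.rpow_mul hd0.le,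
      AdmissibleExponent.weight]
    simp only [← hd]
    rw [Real.rpow_add hd0, Real.rpow_natCast]
    field_simp
  have h3 : |f x - f y| = d ^ s * (|f x - f y| / d ^ s) := by field_simp
  rw [h2] at h1
  have hT0 : 0 < T := by linarith
  calc |f x - f y| = d ^ s * (|f x - f y| / d ^ s) := h3
    _ ≤ r ^ s * (T + T ^ (1 - m) * r ^ N * (|f x - f y| ^ p x y * p.weight (x, y))) := by
      have h4 : d ^ s ≤ r ^ s := Real.rpow_le_rpow hd0.le hxy hs0.le
      have h5 : d ^ N * (|f x - f y| ^ p x y * p.weight (x, y)) * T ^ (1 - m) ≤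
          T ^ (1 - m) * r ^ N * (|f x - f y| ^ p x y * p.weight (x, y)) := by
        have h6 : d ^ N ≤ r ^ N := by gcongr
        calc _ = T ^ (1 - m) * d ^ N * (|f x - f y| ^ p x y * p.weight (x, y)) := by ring
          _ ≤ _ := by gcongr
      gcongr
      linarith

lemma lintegral_ball_abs_sub_le (hs0 : 0 < s) (p : AdmissibleExponent N s) (f : Space N → ℝ)
    {x : Space N} {r T m : ℝ} (hr : 0 < r) (hT : 1 ≤ T) (hm : 1 ≤ m)
    (hp : ∀ y ∈ Metric.ball x r, m ≤ p x y) (hA : pointEnergy p f x ≠ ⊤) :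
    ∫⁻ y in Metric.ball x r, ENNReal.ofReal |f x - f y| ≤
      ENNReal.ofReal (r ^ s * r ^ N *
        (T * unitBallVolume N + T ^ (1 - m) * (pointEnergy p f x).toReal)) := by
  have hω := unitBallVolume_pos N
  have hT0 : 0 < T := by linarith
  calc ∫⁻ y in Metric.ball x r, ENNReal.ofReal |f x - f y|
      ≤ ∫⁻ y in Metric.ball x r, (ENNReal.ofReal (r ^ s * T) +
          ENNReal.ofReal (r ^ s * (T ^ (1 - m) * r ^ N)) *
            ENNReal.ofReal (|f x - f y| ^ p x y * p.weight (x, y))) := by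
        refine setLIntegral_mono' measurableSet_ball fun y hy => ?_
        have hw := p.weight_nonneg (x, y)
        rw [← ENNReal.ofReal_mul (by positivity), ← ENNReal.ofReal_add (by positivity)
          (by positivity)]
        apply ENNReal.ofReal_le_ofReal
        have hxy : ‖x - y‖ ≤ r := by
          rw [← dist_eq_norm, dist_comm]; exact (Metric.mem_ball.1 hy).le
        refine (abs_sub_le_energy hs0 p f hT hm hxy (hp y hy)).trans (le_of_eq ?_)
        ring
    _ ≤ ENNReal.ofReal (r ^ s * T) * volume (Metric.ball x r) +
          ENNReal.ofReal (r ^ s * (T ^ (1 - m) * r ^ N)) * pointEnergy p f x := by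
        rw [lintegral_add_left measurable_const, setLIntegral_const,
          lintegral_const_mul' _ _ ENNReal.ofReal_ne_top]
        gcongr
        exact setLIntegral_le_lintegral _ _
    _ = _ := by
        rw [volume_ball_eq x hr, ← ENNReal.ofReal_mul (by positivity)]
        nth_rewrite 1 [← ENNReal.ofReal_toReal hA]
        rw [← ENNReal.ofReal_mul (by positivity), ← ENNReal.ofReal_add (by positivity)
          (by positivity)]
        congr 1
        ring

/-- A point value is controlled by the energy at this point and an average over a ball. -/
lemma abs_mul_volume_le (hs0 : 0 < s) (p : AdmissibleExponent N s) {f : Space N → ℝ}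
    (hf : Integrable f) {x z : Space N} {r ρ T m : ℝ} (hr : 0 < r) (hρ : 0 < ρ) (hT : 1 ≤ T)
    (hm : 1 ≤ m) (hball : Metric.ball z r ⊆ Metric.ball x ρ)
    (hp : ∀ y ∈ Metric.ball x ρ, m ≤ p x y) (hA : pointEnergy p f x ≠ ⊤) :
    |f x| * (unitBallVolume N * r ^ N) ≤ ρ ^ s * ρ ^ N *
        (T * unitBallVolume N + T ^ (1 - m) * (pointEnergy p f x).toReal) +
      |∫ y in Metric.ball z r, f y| := by
  have hω := unitBallVolume_pos N
  have hT0 : 0 < T := by linarith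
  have hvol : (volume (Metric.ball z r)).toReal = unitBallVolume N * r ^ N := by
    rw [volume_ball_eq z hr, ENNReal.toReal_ofReal (by positivity)]
  -- Two balls are kept apart: the average is over a ball about `z`, which for compactness is one of
  -- finitely many centres, whereas the energy estimate needs a ball about `x`.
  have hc : IntegrableOn (fun _ => f x) (Metric.ball z r) := by
    exact integrableOn_const measure_ball_lt_top.ne
  have h1 : f x * (unitBallVolume N * r ^ N) =
      (∫ y in Metric.ball z r, (f x - f y)) + ∫ y in Metric.ball z r, f y := by
    rw [integral_sub hc hf.integrableOn]
    simp [measureReal_def, hvol, mul_comm]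
  have h2 : |∫ y in Metric.ball z r, (f x - f y)| ≤ ρ ^ s * ρ ^ N *
        (T * unitBallVolume N + T ^ (1 - m) * (pointEnergy p f x).toReal) := by
    have h3 : |∫ y in Metric.ball z r, (f x - f y)| ≤
        (∫⁻ y in Metric.ball z r, ENNReal.ofReal |f x - f y|).toReal := by
      have := norm_integral_le_lintegral_norm (μ := volume.restrict (Metric.ball z r))
        fun y => f x - f y
      simpa only [Real.norm_eq_abs] using this
    refine h3.trans (ENNReal.toReal_le_of_le_ofReal (by positivity) ?_)
    exact (lintegral_mono_set hball).trans (lintegral_ball_abs_sub_le hs0 p f hρ hT hm hp hA)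
  calc |f x| * (unitBallVolume N * r ^ N) = |f x * (unitBallVolume N * r ^ N)| := by
        rw [abs_mul, abs_of_nonneg (by positivity : 0 ≤ unitBallVolume N * r ^ N)]
    _ ≤ _ := by
        rw [h1]
        exact (abs_add_le _ _).trans (by gcongr)

/-- The gain of integrability at a point. -/
lemma abs_rpow_le_energy (hs0 : 0 < s) (p : AdmissibleExponent N s) {f : Space N → ℝ}
    (hf : Integrable f) {x : Space N} {b r : ℝ} (hb : ∀ x y, p x y ≤ b) (hr : 0 < r)
    (hp : ∀ y ∈ Metric.ball x r, p x x - s / (N * b) ≤ p x y) (hA : pointEnergy p f x ≠ ⊤) :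
    |f x| ^ p x x ≤ (2 * r ^ s + (∫ y, |f y|) / (unitBallVolume N * r ^ N)) ^ p x x *
      (1 + (pointEnergy p f x).toReal / unitBallVolume N) := by
  have hω := unitBallVolume_pos N
  set ω := unitBallVolume N with hωdef
  set A := (pointEnergy p f x).toReal with hAdef
  have hA0 : 0 ≤ A := ENNReal.toReal_nonneg
  set P := p x x with hP
  have hP1 : 1 ≤ P := p.one_le x x
  have hP0 : 0 < P := by linarith
  have hb1 : P ≤ b := hb x x
  have hb0 : 0 < b := by linarith
  have hN : 0 < (N : ℝ) := by exact_mod_cast p.dim_pos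
  set m := max 1 (P - s / (N * b)) with hm
  have hm1 : 1 ≤ m := le_max_left _ _
  have hm0 : 0 < m := by linarith
  set G := 1 + A / ω with hG
  have hG1 : 1 ≤ G := by have : 0 ≤ A / ω := by positivity
                         linarith
  have hG0 : 0 < G := by linarith
  -- The radius `ρ = r * G ^ (-θ)` shrinks as the energy grows. The average then costs `ρ ^ (-N) = r
  -- ^ (-N) * G ^ (1 / b)`, and `1 / b ≤ 1 / P`; in exchange `ρ ^ s` gains `G ^ (-s / (N * b))`,
  -- which absorbs the oscillation `P - m ≤ s / (N * b)` of the exponent.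
  set θ := 1 / (N * b) with hθ
  have hθ0 : 0 < θ := by positivity
  set ρ := r * G ^ (-θ) with hρ
  have hρ0 : 0 < ρ := by positivity
  have hρr : ρ ≤ r := mul_le_of_le_one_right hr.le
    (Real.rpow_le_one_of_one_le_of_nonpos hG1 (by linarith))
  -- This level balances the two terms of the truncation: `T ^ (1 - m) * G = T`.
  set T := G ^ (1 / m) with hT
  have hT1 : 1 ≤ T := Real.one_le_rpow hG1 (by positivity)
  have hT0 : 0 < T := by linarith
  have h1 := abs_mul_volume_le hs0 p hf hρ0 hρ0 hT1 hm1 (subset_refl (Metric.ball x ρ))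
    (fun y hy => max_le (p.one_le x y) (hp y (Metric.ball_subset_ball hρr hy))) hA
  rw [← hωdef, ← hAdef] at h1
  set L := ∫ y, |f y| with hL
  have hL0 : 0 ≤ L := integral_nonneg fun _ => abs_nonneg _
  have h2 : |∫ y in Metric.ball x ρ, f y| ≤ L := by
    refine (abs_integral_le_integral_abs (f := f)).trans ?_
    exact setIntegral_le_integral hf.abs (ae_of_all _ fun _ => abs_nonneg _)
  have h3 : T * ω + T ^ (1 - m) * A ≤ 2 * T * ω := by
    have h4 : T ^ (1 - m) * G = T := by
      have hTm : T ^ m = G := by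
        rw [hT, ← Real.rpow_mul hG0.le, one_div_mul_cancel hm0.ne', Real.rpow_one]
      nth_rewrite 1 [← hTm]
      rw [← Real.rpow_add hT0]; norm_num
    have h5 : A ≤ G * ω := by rw [hG, add_mul, div_mul_cancel₀ _ hω.ne']; linarith
    calc T * ω + T ^ (1 - m) * A ≤ T * ω + T ^ (1 - m) * (G * ω) := by gcongr
      _ = 2 * T * ω := by rw [← mul_assoc, h4]; ring
  have h6 : |f x| ≤ 2 * ρ ^ s * T + L / (ω * ρ ^ N) := by
    have hpos : 0 < ω * ρ ^ N := by positivity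
    have : |f x| * (ω * ρ ^ N) ≤ (2 * ρ ^ s * T + L / (ω * ρ ^ N)) * (ω * ρ ^ N) := by
      rw [add_mul, div_mul_cancel₀ _ hpos.ne']
      calc _ ≤ _ := h1
        _ ≤ ρ ^ s * ρ ^ N * (2 * T * ω) + L := by gcongr
        _ = _ := by ring
    exact le_of_mul_le_mul_right this hpos
  have h7 : ρ ^ s * T ≤ r ^ s * G ^ (1 / P) := by
    rw [hρ, Real.mul_rpow hr.le (by positivity), ← Real.rpow_mul hG0.le, mul_assoc, hT,
      ← Real.rpow_add hG0]
    refine mul_le_mul_of_nonneg_left (Real.rpow_le_rpow_of_exponent_le hG1 ?_) (by positivity)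
    · have h8 : 1 / m - 1 / P ≤ s / (N * b) := by
        have : P - m ≤ s / (N * b) := by linarith [le_max_right 1 (P - s / (N * b))]
        have hsb : 0 ≤ s / (N * b) := by positivity
        rw [div_sub_div _ _ hm0.ne' hP0.ne', div_le_iff₀ (by positivity)]
        have : 1 ≤ m * P := by nlinarith
        nlinarith
      have : s / (N * b) = θ * s := by rw [hθ]; ring
      linarith
  have h9 : L / (ω * ρ ^ N) ≤ L / (ω * r ^ N) * G ^ (1 / P) := by
    have e : ρ ^ N = r ^ N * (G ^ (1 / b))⁻¹ := by
      rw [hρ, mul_pow, ← Real.rpow_natCast (G ^ (-θ)), ← Real.rpow_mul hG0.le,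
        ← Real.rpow_neg hG0.le]
      congr 2
      rw [hθ]; field_simp
    rw [e, ← mul_assoc, ← div_div, div_inv_eq_mul]
    have : G ^ (1 / b) ≤ G ^ (1 / P) := by
      apply Real.rpow_le_rpow_of_exponent_le hG1
      gcongr
    gcongr
  have h10 : |f x| ≤ (2 * r ^ s + L / (ω * r ^ N)) * G ^ (1 / P) := by
    calc |f x| ≤ _ := h6
      _ = 2 * (ρ ^ s * T) + L / (ω * ρ ^ N) := by ring
      _ ≤ 2 * (r ^ s * G ^ (1 / P)) + L / (ω * r ^ N) * G ^ (1 / P) := by gcongr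
      _ = _ := by ring
  calc |f x| ^ P ≤ ((2 * r ^ s + L / (ω * r ^ N)) * G ^ (1 / P)) ^ P := by gcongr
    _ = _ := by
      rw [Real.mul_rpow (by positivity) (by positivity), ← Real.rpow_mul hG0.le,
        one_div_mul_cancel hP0.ne', Real.rpow_one]

lemma ae_pointEnergy_ne_top (p : AdmissibleExponent N s) {f : Space N → ℝ} (hf : Measurable f)
    (hE : gagliardoEnergy p f ≠ ⊤) : ∀ᵐ x, pointEnergy p f x ≠ ⊤ := by
  rw [← lintegral_pointEnergy p hf] at hE
  exact (ae_lt_top (measurable_pointEnergy p hf) hE).mono fun x hx => hx.ne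

/-- By Tonelli, a pointwise bound affine in the energy at `x` integrates to a bound by the total
energy. All three integral estimates over `Ω` below pass through it. -/
lemma setLIntegral_le_of_pointEnergy (p : AdmissibleExponent N s) {Ω : Set (Space N)}
    (hΩm : MeasurableSet Ω) (hΩb : Bornology.IsBounded Ω) {f g : Space N → ℝ}
    (hf : Measurable f) {M c d : ℝ} (hM : 0 ≤ M) (hc : 0 ≤ c) (hd : 0 ≤ d)
    (hE : gagliardoEnergy p f ≤ ENNReal.ofReal M)
    (hg : ∀ x ∈ Ω, pointEnergy p f x ≠ ⊤ →
      g x ≤ c * (1 + (pointEnergy p f x).toReal / unitBallVolume N) + d) :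
    ∫⁻ x in Ω, ENNReal.ofReal (g x) ≤ ENNReal.ofReal
      (c * ((volume Ω).toReal + M / unitBallVolume N) + d * (volume Ω).toReal) := by
  have hω := unitBallVolume_pos N
  have hV : volume Ω ≠ ⊤ := hΩb.measure_lt_top.ne
  calc ∫⁻ x in Ω, ENNReal.ofReal (g x)
      ≤ ∫⁻ x in Ω, (ENNReal.ofReal (c + d) +
          ENNReal.ofReal (c / unitBallVolume N) * pointEnergy p f x) := by
        refine lintegral_mono_ae ?_
        filter_upwards [ae_restrict_of_ae (ae_pointEnergy_ne_top p hf
          (hE.trans_lt ENNReal.ofReal_lt_top).ne), ae_restrict_mem hΩm] with x hx hxΩ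
        nth_rewrite 1 [← ENNReal.ofReal_toReal hx]
        rw [← ENNReal.ofReal_mul (by positivity), ← ENNReal.ofReal_add (by positivity)
          (by positivity)]
        refine ENNReal.ofReal_le_ofReal ((hg x hxΩ hx).trans (le_of_eq ?_))
        ring
    _ ≤ ENNReal.ofReal (c + d) * volume Ω +
          ENNReal.ofReal (c / unitBallVolume N) * ENNReal.ofReal M := by
        rw [lintegral_add_left measurable_const, setLIntegral_const,
          lintegral_const_mul' _ _ ENNReal.ofReal_ne_top]
        gcongr
        refine (setLIntegral_le_lintegral _ _).trans ?_
        rw [lintegral_pointEnergy p hf]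
        exact hE
    _ = _ := by
        nth_rewrite 1 [← ENNReal.ofReal_toReal hV]
        rw [← ENNReal.ofReal_mul (by positivity), ← ENNReal.ofReal_mul (by positivity),
          ← ENNReal.ofReal_add (by positivity) (by positivity)]
        congr 1
        ring

lemma setLIntegral_eq_of_ae_zero {Ω : Set (Space N)} (hΩm : MeasurableSet Ω) {f : Space N → ℝ}
    (hf0 : ∀ᵐ x, x ∉ Ω → f x = 0) :
    ∫⁻ x in Ω, ENNReal.ofReal |f x| = ∫⁻ x, ENNReal.ofReal |f x| := by
  rw [← lintegral_indicator hΩm]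
  refine lintegral_congr_ae (hf0.mono fun x hx => ?_)
  by_cases h : x ∈ Ω
  · simp [h]
  · simp [h, hx h]

/-- A Poincaré inequality in `L¹`. -/
lemma exists_lintegral_abs_le (hs0 : 0 < s) (p : AdmissibleExponent N s) {Ω : Set (Space N)}
    (hΩm : MeasurableSet Ω) (hΩb : Bornology.IsBounded Ω) (M : ℝ) :
    ∃ C : ℝ, 0 ≤ C ∧ ∀ f : Space N → ℝ, Measurable f → (∀ᵐ x, x ∉ Ω → f x = 0) →
      gagliardoEnergy p f ≤ ENNReal.ofReal M →
      ∫⁻ x, ENNReal.ofReal |f x| ≤ ENNReal.ofReal C := by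
  obtain ⟨b, -, hb⟩ := p.exists_upper
  have hb0 : 0 < b := (p.pos 0 0).trans_le (hb 0 0)
  have hω := unitBallVolume_pos N
  set ω := unitBallVolume N with hωdef
  obtain ⟨R, hR0, hR⟩ := hΩb.subset_ball_lt 0 0
  have : Nonempty (Fin N) := ⟨⟨0, p.dim_pos⟩⟩
  -- The unit ball about `e` lies outside the ball of radius `R` containing `Ω`, so `f` vanishes
  -- a.e. there and `|f x - f y| = |f x|`. Its points are at distance at most `D = 2 * R + 2` from
  -- `Ω`, so the weight is at least `c⁻¹`.
  obtain ⟨e, he⟩ := exists_norm_eq (Space N)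
    (show 0 ≤ R + 1 by positivity)
  set D := 2 * R + 2 with hD
  have hD1 : 1 ≤ D := by linarith
  set c := D ^ ((N : ℝ) + s * b) with hc
  have hc0 : 0 < c := by positivity
  set M' := max M 0 with hM'
  refine ⟨(1 + c) * ((volume Ω).toReal + M' / ω) + 0 * (volume Ω).toReal, by positivity,
    fun f hf hf0 hE => ?_⟩
  rw [← setLIntegral_eq_of_ae_zero hΩm hf0]
  refine setLIntegral_le_of_pointEnergy p hΩm hΩb hf (le_max_right _ _) (by positivity) le_rfl
    (hE.trans (ENNReal.ofReal_le_ofReal (le_max_left _ _))) fun x hx hA => ?_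
  rw [← hωdef, add_zero]
  set A := (pointEnergy p f x).toReal with hAdef
  have hA0 : 0 ≤ A := ENNReal.toReal_nonneg
  have hxR : ‖x‖ < R := by simpa using hR hx
  have key : ENNReal.ofReal |f x| * volume (Metric.ball e 1) ≤
      volume (Metric.ball e 1) + ENNReal.ofReal c * pointEnergy p f x := by
    calc ENNReal.ofReal |f x| * volume (Metric.ball e 1)
        = ∫⁻ y in Metric.ball e 1, ENNReal.ofReal |f x| := by rw [setLIntegral_const]
      _ ≤ ∫⁻ y in Metric.ball e 1, (1 + ENNReal.ofReal c *
            ENNReal.ofReal (|f x - f y| ^ p x y * p.weight (x, y))) := by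
          refine lintegral_mono_ae ?_
          filter_upwards [ae_restrict_of_ae hf0, ae_restrict_mem measurableSet_ball] with y hy hye
          have hye' : ‖y - e‖ < 1 := by simpa [dist_eq_norm] using hye
          have hyR : R < ‖y‖ := by
            have := norm_sub_norm_le e y
            rw [norm_sub_rev] at this
            linarith
          have hyΩ : y ∉ Ω := fun h => by
            have : ‖y‖ < R := by simpa using hR h
            linarith
          rw [hy hyΩ, sub_zero]
          have hw := p.weight_nonneg (x, y)
          rw [← ENNReal.ofReal_mul (by positivity), ← ENNReal.ofReal_one,
            ← ENNReal.ofReal_add zero_le_one (by positivity)]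
          apply ENNReal.ofReal_le_ofReal
          have hd0 : 0 < ‖x - y‖ := by
            have := norm_sub_norm_le y x
            rw [norm_sub_rev] at this
            linarith
          have hdD : ‖x - y‖ ≤ D := by
            have h1 := norm_sub_le x y
            have h2 := norm_add_le (y - e) e
            rw [sub_add_cancel] at h2
            linarith
          have hcw : 1 ≤ c * p.weight (x, y) := by
            rw [AdmissibleExponent.weight, ← div_eq_mul_inv, one_le_div (by positivity)]
            simp only
            have hp0 := p.pos x y
            calc ‖x - y‖ ^ ((N : ℝ) + s * p x y) ≤ D ^ ((N : ℝ) + s * p x y) := by gcongr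
              _ ≤ c := by
                refine Real.rpow_le_rpow_of_exponent_le hD1 ?_
                have := hb x y
                gcongr
          have h1 : |f x| ≤ 1 + |f x| ^ p x y := by
            have h2 := le_add_rpow_mul (abs_nonneg (f x)) le_rfl le_rfl (p.one_le x y)
            simpa using h2
          have h3 : |f x| ^ p x y ≤ c * (|f x| ^ p x y * p.weight (x, y)) := by
            rw [mul_left_comm]
            exact le_mul_of_one_le_right (by positivity) hcw
          linarith
      _ ≤ _ := by
          rw [lintegral_add_left measurable_const, setLIntegral_const, one_mul,
            lintegral_const_mul' _ _ ENNReal.ofReal_ne_top]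
          gcongr
          exact setLIntegral_le_lintegral _ _
  rw [volume_ball_eq e one_pos, one_pow, mul_one, ← hωdef, ← ENNReal.ofReal_mul (abs_nonneg _),
    ← ENNReal.ofReal_toReal hA, ← hAdef, ← ENNReal.ofReal_mul hc0.le,
    ← ENNReal.ofReal_add hω.le (by positivity), ENNReal.ofReal_le_ofReal_iff (by positivity)] at key
  have h4 : |f x| ≤ 1 + c * (A / ω) := by
    refine le_of_mul_le_mul_right (key.trans (le_of_eq ?_)) hω
    field_simp
  have h5 : 0 ≤ A / ω := by positivity
  nlinarith

/-- The diagonal over `closure Ω` is compact, which makes the continuity of `p` uniform there even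
against points `y` outside `Ω`. -/
lemma exists_radius_of_exponent (p : AdmissibleExponent N s) {Ω : Set (Space N)}
    (hΩb : Bornology.IsBounded Ω) {η : ℝ} (hη : 0 < η) :
    ∃ r : ℝ, 0 < r ∧ ∀ x ∈ Ω, ∀ y ∈ Metric.ball x r, p x x - η ≤ p x y := by
  have hK : IsCompact ((fun x : Space N => (x, x)) '' closure Ω) :=
    hΩb.isCompact_closure.image (by fun_prop)
  have h := hK.uniformContinuousAt_of_continuousAt _
    (fun z _ => p.continuous_toFun.continuousAt) (Metric.dist_mem_uniformity hη)
  obtain ⟨r, hr, h⟩ := Metric.mem_uniformity_dist.1 h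
  refine ⟨r, hr, fun x hx y hy => ?_⟩
  have h1 := @h (x, x) (x, y) (by
    rw [Prod.dist_eq, dist_self, dist_comm]
    simpa [hr] using hy) ⟨x, subset_closure hx, rfl⟩
  have h2 : |p x x - p x y| < η := h1
  linarith [(abs_lt.1 h2).2]

/-! ### Integral estimates on `Ω`: boundedness, smallness, and control by averages -/

section Embedding

variable {p : AdmissibleExponent N s} {Ω : Set (Space N)} {f : Space N → ℝ}

lemma integrable_of_lintegral_abs (hf : Measurable f)
    (h : ∫⁻ x, ENNReal.ofReal |f x| ≠ ⊤) : Integrable f := by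
  refine ⟨hf.aestronglyMeasurable, ?_⟩
  rw [hasFiniteIntegral_iff_norm]
  exact lt_top_iff_ne_top.2 h

lemma integrable_of_gagliardoEnergy (hs0 : 0 < s) (hΩm : MeasurableSet Ω)
    (hΩb : Bornology.IsBounded Ω) (hf : Measurable f) (hf0 : ∀ᵐ x, x ∉ Ω → f x = 0)
    (hE : gagliardoEnergy p f ≠ ⊤) : Integrable f := by
  obtain ⟨C, -, hC⟩ := exists_lintegral_abs_le hs0 p hΩm hΩb (gagliardoEnergy p f).toReal
  exact integrable_of_lintegral_abs hf
    ((hC f hf hf0 (ENNReal.ofReal_toReal hE).ge).trans_lt ENNReal.ofReal_lt_top).ne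

lemma integral_abs_le_of_lintegral (hf : Measurable f) {C : ℝ} (hC : 0 ≤ C)
    (h : ∫⁻ x, ENNReal.ofReal |f x| ≤ ENNReal.ofReal C) : ∫ x, |f x| ≤ C := by
  have hfi := integrable_of_lintegral_abs hf (h.trans_lt ENNReal.ofReal_lt_top).ne
  rwa [← ofReal_integral_eq_lintegral_ofReal hfi.abs (ae_of_all _ fun _ => abs_nonneg _),
    ENNReal.ofReal_le_ofReal_iff hC] at h

/-- Here `κ` bounds the prefactor of `abs_rpow_le_energy` for every exponent at once; a finite `κ`
gives boundedness, a small one gives convergence. -/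
lemma lintegral_rpow_le (hs0 : 0 < s) (hΩm : MeasurableSet Ω)
    (hΩb : Bornology.IsBounded Ω) {b r κ M : ℝ} (hb : ∀ x y, p x y ≤ b) (hr : 0 < r)
    (hp : ∀ x ∈ Ω, ∀ y ∈ Metric.ball x r, p x x - s / (N * b) ≤ p x y)
    (hf : Measurable f) (hf0 : ∀ᵐ x, x ∉ Ω → f x = 0) (hM : 0 ≤ M)
    (hE : gagliardoEnergy p f ≤ ENNReal.ofReal M)
    (hκ : ∀ P ∈ Set.Icc 1 b,
      (2 * r ^ s + (∫ y, |f y|) / (unitBallVolume N * r ^ N)) ^ P ≤ κ) :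
    ∫⁻ x in Ω, ENNReal.ofReal (|f x| ^ p x x) ≤
      ENNReal.ofReal (κ * ((volume Ω).toReal + M / unitBallVolume N)) := by
  have hω := unitBallVolume_pos N
  have hfi := integrable_of_gagliardoEnergy hs0 hΩm hΩb hf hf0
    (hE.trans_lt ENNReal.ofReal_lt_top).ne
  have hL : 0 ≤ ∫ y, |f y| := integral_nonneg fun _ => abs_nonneg _
  have hκ0 : 0 ≤ κ := le_trans (by positivity) (hκ (p 0 0) ⟨p.one_le 0 0, hb 0 0⟩)
  have := setLIntegral_le_of_pointEnergy p hΩm hΩb (g := fun x => |f x| ^ p x x) hf hM hκ0 le_rfl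
    hE fun x hx hA => by
      rw [add_zero]
      refine (abs_rpow_le_energy hs0 p hfi hb hr (hp x hx) hA).trans ?_
      have := hκ (p x x) ⟨p.one_le x x, hb x x⟩
      gcongr
  rwa [zero_mul, add_zero] at this

/-- Bounded subsets for the Gagliardo energy are bounded for the Lebesgue energy. -/
lemma exists_lintegral_rpow_le (hs0 : 0 < s) (p : AdmissibleExponent N s) (hΩm : MeasurableSet Ω)
    (hΩb : Bornology.IsBounded Ω) (M : ℝ) :
    ∃ C : ℝ, 0 ≤ C ∧ ∀ f : Space N → ℝ, Measurable f → (∀ᵐ x, x ∉ Ω → f x = 0) →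
      gagliardoEnergy p f ≤ ENNReal.ofReal M →
      ∫⁻ x in Ω, ENNReal.ofReal (|f x| ^ p x x) ≤ ENNReal.ofReal C := by
  obtain ⟨b, -, hb⟩ := p.exists_upper
  have hb0 : 0 < b := (p.pos 0 0).trans_le (hb 0 0)
  have hω := unitBallVolume_pos N
  have hN : 0 < (N : ℝ) := by exact_mod_cast p.dim_pos
  obtain ⟨r, hr, hp⟩ := exists_radius_of_exponent p hΩb (η := s / (N * b)) (by positivity)
  obtain ⟨L, hL0, hL⟩ := exists_lintegral_abs_le hs0 p hΩm hΩb M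
  -- The added `1` makes the base at least `1`, so the exponent may be raised to `b`.
  refine ⟨(1 + (2 * r ^ s + L / (unitBallVolume N * r ^ N))) ^ b *
    ((volume Ω).toReal + max M 0 / unitBallVolume N), by positivity, fun f hf hf0 hE => ?_⟩
  refine lintegral_rpow_le hs0 hΩm hΩb hb hr hp hf hf0 (le_max_right _ _)
    (hE.trans (ENNReal.ofReal_le_ofReal (le_max_left _ _))) fun P hP => ?_
  have h1 := integral_abs_le_of_lintegral hf hL0 (hL f hf hf0 hE)
  have h2 : 0 ≤ ∫ y, |f y| := integral_nonneg fun _ => abs_nonneg _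
  have hP0 : 0 ≤ P := zero_le_one.trans hP.1
  calc _ ≤ (1 + (2 * r ^ s + L / (unitBallVolume N * r ^ N))) ^ P := by
        refine Real.rpow_le_rpow (by positivity) ?_ hP0
        have : (∫ y, |f y|) / (unitBallVolume N * r ^ N) ≤ L / (unitBallVolume N * r ^ N) := by
          gcongr
        linarith
    _ ≤ _ := Real.rpow_le_rpow_of_exponent_le (le_add_of_nonneg_right (by positivity)) hP.2

/-- On bounded subsets for the Gagliardo energy, convergence in `L¹` implies convergence in the
variable exponent Lebesgue space. -/
lemma exists_lintegral_rpow_le_of_integral_le (hs0 : 0 < s) (p : AdmissibleExponent N s)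
    (hΩm : MeasurableSet Ω) (hΩb : Bornology.IsBounded Ω) (M : ℝ) {ε : ℝ} (hε : 0 < ε) :
    ∃ δ : ℝ, 0 < δ ∧ ∀ f : Space N → ℝ, Measurable f → (∀ᵐ x, x ∉ Ω → f x = 0) →
      gagliardoEnergy p f ≤ ENNReal.ofReal M → ∫ x, |f x| ≤ δ →
      ∫⁻ x in Ω, ENNReal.ofReal (|f x| ^ p x x) ≤ ENNReal.ofReal ε := by
  obtain ⟨b, -, hb⟩ := p.exists_upper
  have hb0 : 0 < b := (p.pos 0 0).trans_le (hb 0 0)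
  have hω := unitBallVolume_pos N
  have hN : 0 < (N : ℝ) := by exact_mod_cast p.dim_pos
  obtain ⟨r₀, hr₀, hp⟩ := exists_radius_of_exponent p hΩb (η := s / (N * b)) (by positivity)
  set B := (volume Ω).toReal + max M 0 / unitBallVolume N + 1 with hB
  have hB0 : 0 < B := by positivity
  -- `κ ≤ 1` gives `κ ^ P ≤ κ`, and `κ * B ≤ ε`. The base is split in two: `r` makes `2 * r ^ s ≤ κ
  -- / 2`, and `δ` makes the `L¹` term at most `κ / 2`.
  set κ := min 1 (ε / B) with hκ
  have hκ0 : 0 < κ := by positivity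
  set r := min r₀ ((κ / 4) ^ (1 / s)) with hr
  have hr0 : 0 < r := by positivity
  have hrs : 2 * r ^ s ≤ κ / 2 := by
    have : r ^ s ≤ ((κ / 4) ^ (1 / s)) ^ s :=
      Real.rpow_le_rpow hr0.le (min_le_right _ _) hs0.le
    rw [← Real.rpow_mul (by positivity), one_div_mul_cancel hs0.ne', Real.rpow_one] at this
    linarith
  refine ⟨κ / 2 * (unitBallVolume N * r ^ N), by positivity, fun f hf hf0 hE hL => ?_⟩
  have h2 : 0 ≤ ∫ y, |f y| := integral_nonneg fun _ => abs_nonneg _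
  have h1 : (∫ y, |f y|) / (unitBallVolume N * r ^ N) ≤ κ / 2 := by
    rwa [div_le_iff₀ (by positivity)]
  refine (lintegral_rpow_le hs0 hΩm hΩb hb hr0
    (fun x hx y hy => hp x hx y (Metric.ball_subset_ball (min_le_left _ _) hy)) hf hf0
    (le_max_right _ _) (hE.trans (ENNReal.ofReal_le_ofReal (le_max_left _ _))) (κ := κ)
    fun P hP => ?_).trans (ENNReal.ofReal_le_ofReal ?_)
  · have hP0 : 0 ≤ P := zero_le_one.trans hP.1
    calc _ ≤ κ ^ P := by
          refine Real.rpow_le_rpow (by positivity) ?_ hP0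
          linarith
      _ ≤ κ ^ (1 : ℝ) := Real.rpow_le_rpow_of_exponent_ge hκ0 (min_le_left _ _) hP.1
      _ = κ := Real.rpow_one _
  · calc κ * ((volume Ω).toReal + max M 0 / unitBallVolume N) ≤ ε / B * B := by
          gcongr
          · exact min_le_right _ _
          · linarith
      _ = ε := div_mul_cancel₀ _ hB0.ne'

/-- On bounded subsets for the Gagliardo energy, finitely many averages control the `L¹` norm up
to a small error. -/
lemma exists_integral_abs_le_of_averages (hs0 : 0 < s) (p : AdmissibleExponent N s)
    (hΩm : MeasurableSet Ω) (hΩb : Bornology.IsBounded Ω) {z : ℕ → Space N} (hz : DenseRange z)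
    (M : ℝ) {ε : ℝ} (hε : 0 < ε) :
    ∃ (t : Finset ℕ) (j : ℕ) (δ : ℝ), 0 < δ ∧ ∀ f : Space N → ℝ, Measurable f →
      (∀ᵐ x, x ∉ Ω → f x = 0) → gagliardoEnergy p f ≤ ENNReal.ofReal M →
      (∀ i ∈ t, |∫ x in Metric.ball (z i) (1 / ((j : ℝ) + 1)), f x| ≤ δ) →
      ∫ x, |f x| ≤ ε := by
  have hω := unitBallVolume_pos N
  set V := (volume Ω).toReal with hV
  set B := V + max M 0 / unitBallVolume N + 1 with hB
  have hB0 : 0 < B := by positivity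
  -- The radius `r = 1 / (j + 1)` makes the energy part at most `ε / 2`; the factor `2 ^ N` is the
  -- volume ratio of balls of radii `2 * r` and `r`.
  obtain ⟨j, hj⟩ := exists_nat_one_div_lt
    (show 0 < (ε / (2 * 2 ^ N * B)) ^ (1 / s) / 2 by positivity)
  set r : ℝ := 1 / ((j : ℝ) + 1) with hr
  have hr0 : 0 < r := by positivity
  have hrs : (2 * r) ^ s * 2 ^ N * B ≤ ε / 2 := by
    have : (2 * r) ^ s ≤ ((ε / (2 * 2 ^ N * B)) ^ (1 / s)) ^ s :=
      Real.rpow_le_rpow (by positivity) (by linarith) hs0.le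
    rw [← Real.rpow_mul (by positivity), one_div_mul_cancel hs0.ne', Real.rpow_one] at this
    calc (2 * r) ^ s * 2 ^ N * B ≤ ε / (2 * 2 ^ N * B) * 2 ^ N * B := by gcongr
      _ = ε / 2 := by field_simp
  obtain ⟨t, ht⟩ := hΩb.isCompact_closure.elim_finite_subcover
    (fun i : ℕ => Metric.ball (z i) r) (fun i => Metric.isOpen_ball) (fun x _ => by
      obtain ⟨i, hi⟩ := hz.exists_dist_lt x hr0
      exact Set.mem_iUnion.2 ⟨i, hi⟩)
  refine ⟨t, j, ε * (unitBallVolume N * r ^ N) / (2 * (V + 1)), by positivity,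
    fun f hf hf0 hE hav => ?_⟩
  have hfi := integrable_of_gagliardoEnergy hs0 hΩm hΩb hf hf0
    (hE.trans_lt ENNReal.ofReal_lt_top).ne
  refine integral_abs_le_of_lintegral hf hε.le ?_
  rw [← setLIntegral_eq_of_ae_zero hΩm hf0]
  refine (setLIntegral_le_of_pointEnergy p hΩm hΩb (g := fun x => |f x|) hf (le_max_right M 0)
    (c := (2 * r) ^ s * 2 ^ N) (d := ε / (2 * (V + 1))) (by positivity) (by positivity)
    (hE.trans (ENNReal.ofReal_le_ofReal (le_max_left _ _))) fun x hx hA => ?_).trans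
    (ENNReal.ofReal_le_ofReal ?_)
  · obtain ⟨i, hi, hxi⟩ := Set.mem_iUnion₂.1 (ht (subset_closure hx))
    have hsub : Metric.ball (z i) r ⊆ Metric.ball x (2 * r) := by
      refine Metric.ball_subset_ball' ?_
      rw [Metric.mem_ball, dist_comm] at hxi
      linarith
    -- With `T = m = 1` only `p ≥ 1` is needed: in `L¹` no gain of integrability is required.
    have h1 := abs_mul_volume_le hs0 p hfi hr0 (show 0 < 2 * r by positivity) le_rfl le_rfl hsub
      (fun y _ => p.one_le x y) hA
    rw [sub_self, Real.rpow_zero, one_mul, one_mul] at h1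
    refine le_of_mul_le_mul_right (h1.trans ((add_le_add_right (hav i hi) _).trans
      (le_of_eq ?_))) (show 0 < unitBallVolume N * r ^ N by positivity)
    rw [mul_pow]
    field_simp
  · have h2 : ε / (2 * (V + 1)) * V ≤ ε / 2 := by
      rw [div_mul_eq_mul_div, div_le_div_iff₀ (by positivity) two_pos]
      nlinarith
    have h3 : (2 * r) ^ s * 2 ^ N * (V + max M 0 / unitBallVolume N) ≤
        (2 * r) ^ s * 2 ^ N * B := by
      gcongr
      linarith
    linarith

end Embedding

/-! ### The modulars of `K` and `k` -/

lemma lintegral_withDensity_ofReal {Z : Type*} [MeasurableSpace Z] {μ : Measure Z} {w h : Z → ℝ}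
    (hw : Measurable w) (hw0 : ∀ z, 0 ≤ w z) (hh : Measurable h) :
    ∫⁻ z, ENNReal.ofReal (h z) ∂μ.withDensity (fun z => ENNReal.ofReal (w z)) =
      ∫⁻ z, ENNReal.ofReal (h z * w z) ∂μ := by
  rw [lintegral_withDensity_eq_lintegral_mul _ hw.ennreal_ofReal hh.ennreal_ofReal]
  refine lintegral_congr fun z => ?_
  rw [Pi.mul_apply, ← ENNReal.ofReal_mul (hw0 z), mul_comm]

lemma integrable_of_lintegral_ofReal {Z : Type*} [MeasurableSpace Z] {μ : Measure Z} {h : Z → ℝ}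
    (hh : Measurable h) (h0 : ∀ z, 0 ≤ h z) (hfin : ∫⁻ z, ENNReal.ofReal (h z) ∂μ ≠ ⊤) :
    Integrable h μ := by
  refine ⟨hh.aestronglyMeasurable, ?_⟩
  rw [hasFiniteIntegral_iff_norm]
  simpa only [Real.norm_of_nonneg (h0 _)] using lt_top_iff_ne_top.2 hfin

lemma ModularMap.ofReal_modular {Z E : Type*} [MeasurableSpace Z] {μ : Measure Z} {q : Z → ℝ}
    [AddCommGroup E] [Module ℝ E] (T : ModularMap μ q E) (u : E) :
    ENNReal.ofReal (T.modular u) = ∫⁻ z, ENNReal.ofReal (|T.toFun u z| ^ q z) ∂μ :=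
  ofReal_integral_eq_lintegral_ofReal (T.integrable u) (ae_of_all _ fun z => by positivity)

variable (p : AdmissibleExponent N s) (Ω : Set (Space N))

lemma X_measurable (u : X p Ω) : Measurable (u : Space N →ₘ[volume] ℝ) :=
  (u : Space N →ₘ[volume] ℝ).stronglyMeasurable.measurable

lemma X_coe_smul (c : ℝ) (u : X p Ω) :
    ⇑((c • u : X p Ω) : Space N →ₘ[volume] ℝ) =ᵐ[volume]
      fun x => c * (u : Space N →ₘ[volume] ℝ) x :=
  AEEqFun.coeFn_smul c (u : Space N →ₘ[volume] ℝ)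

lemma X_coe_add (u v : X p Ω) :
    ⇑((u + v : X p Ω) : Space N →ₘ[volume] ℝ) =ᵐ[volume]
      fun x => (u : Space N →ₘ[volume] ℝ) x + (v : Space N →ₘ[volume] ℝ) x :=
  AEEqFun.coeFn_add (u : Space N →ₘ[volume] ℝ) v

lemma X_coe_sub (u v : X p Ω) :
    ⇑((u - v : X p Ω) : Space N →ₘ[volume] ℝ) =ᵐ[volume]
      fun x => (u : Space N →ₘ[volume] ℝ) x - (v : Space N →ₘ[volume] ℝ) x :=
  AEEqFun.coeFn_sub (u : Space N →ₘ[volume] ℝ) v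

/-- The measure `|x - y|^{-(N + s p(x,y))} dx dy / p(x,y)`. -/
def gagliardoMeasure : Measure (Space N × Space N) :=
  volume.withDensity fun z => ENNReal.ofReal (p.weightDiv z)

/-- The measure `dx / p(x,x)` on `Ω`. -/
def lebesgueMeasure : Measure (Space N) :=
  (volume.restrict Ω).withDensity fun x => ENNReal.ofReal (p x x)⁻¹

lemma lintegral_gagliardoMeasure {f : Space N → ℝ} (hf : Measurable f) :
    ∫⁻ z : Space N × Space N, ENNReal.ofReal (|f z.1 - f z.2| ^ p z.1 z.2) ∂gagliardoMeasure p =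
      gagliardoModular p f := by
  have := p.measurable
  rw [gagliardoModular_eq, gagliardoMeasure,
    lintegral_withDensity_ofReal p.weightDiv_measurable p.weightDiv_nonneg (by fun_prop)]

lemma lintegral_lebesgueMeasure {f : Space N → ℝ} (hf : Measurable f) :
    ∫⁻ x, ENNReal.ofReal (|f x| ^ p x x) ∂lebesgueMeasure p Ω =
      ∫⁻ x in Ω, ENNReal.ofReal (|f x| ^ p x x / p x x) := by
  have := p.measurable_diag
  rw [lebesgueMeasure, lintegral_withDensity_ofReal (w := fun x => (p x x)⁻¹) this.inv
    (fun x => inv_nonneg.2 (p.pos x x).le) (by fun_prop)]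
  simp only [div_eq_mul_inv]

/-- The modular map `u ↦ u(x) - u(y)` defining the functional `K`. -/
def gagliardoMap : ModularMap (gagliardoMeasure p) (fun z => p z.1 z.2) (X p Ω) where
  toFun u z := (u : Space N →ₘ[volume] ℝ) z.1 - (u : Space N →ₘ[volume] ℝ) z.2
  measurable_toFun u := by
    have := X_measurable p Ω u
    fun_prop
  map_add_ae u v := by
    refine (withDensity_absolutelyContinuous _ _).ae_le ?_
    filter_upwards [ae_prod_congr (X_coe_add p Ω u v)] with z hz
    rw [hz.1, hz.2]; ring
  map_smul_ae c u := by
    refine (withDensity_absolutelyContinuous _ _).ae_le ?_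
    filter_upwards [ae_prod_congr (X_coe_smul p Ω c u)] with z hz
    rw [hz.1, hz.2]; ring
  integrable u := by
    have h1 := X_measurable p Ω u
    have h2 := p.measurable
    refine integrable_of_lintegral_ofReal (by fun_prop) (fun z => by positivity) ?_
    rw [lintegral_gagliardoMeasure p h1]
    exact ((gagliardoModular_le_energy p _).trans_lt u.2.1.2).ne
  measurable_exponent := p.measurable
  lower := p.exists_lower.choose
  one_lt_lower := p.exists_lower.choose_spec.1
  upper := p.exists_upper.choose
  mem_Icc z := ⟨p.exists_lower.choose_spec.2 _ _, p.exists_upper.choose_spec.2 _ _⟩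

/-- The modular map `u ↦ u` defining the functional `k`. -/
def lebesgueMap : ModularMap (lebesgueMeasure p Ω) (fun x => p x x) (X p Ω) where
  toFun u := (u : Space N →ₘ[volume] ℝ)
  measurable_toFun u := X_measurable p Ω u
  map_add_ae u v := (withDensity_absolutelyContinuous _ _).ae_le
    (ae_restrict_of_ae (X_coe_add p Ω u v))
  map_smul_ae c u := (withDensity_absolutelyContinuous _ _).ae_le
    (ae_restrict_of_ae (X_coe_smul p Ω c u))
  integrable u := by
    have h1 := X_measurable p Ω u
    have h2 := p.measurable_diag
    refine integrable_of_lintegral_ofReal (by fun_prop) (fun z => by positivity) ?_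
    rw [lintegral_lebesgueMeasure p Ω h1]
    refine (lt_of_le_of_lt ?_ u.2.1.1).ne
    refine (setLIntegral_le_lintegral _ _).trans (lintegral_mono fun x => ?_)
    exact ENNReal.ofReal_le_ofReal (div_le_self (by positivity) (p.one_le x x))
  measurable_exponent := p.measurable_diag
  lower := p.exists_lower.choose
  one_lt_lower := p.exists_lower.choose_spec.1
  upper := p.exists_upper.choose
  mem_Icc z := ⟨p.exists_lower.choose_spec.2 _ _, p.exists_upper.choose_spec.2 _ _⟩

lemma ofReal_gagliardoMap_modular (u : X p Ω) :
    ENNReal.ofReal ((gagliardoMap p Ω).modular u) =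
      gagliardoModular p (u : Space N →ₘ[volume] ℝ) := by
  rw [ModularMap.ofReal_modular]
  exact lintegral_gagliardoMeasure p (X_measurable p Ω u)

lemma ofReal_lebesgueMap_modular (u : X p Ω) :
    ENNReal.ofReal ((lebesgueMap p Ω).modular u) =
      ∫⁻ x in Ω, ENNReal.ofReal (|(u : Space N →ₘ[volume] ℝ) x| ^ p x x / p x x) := by
  rw [ModularMap.ofReal_modular]
  exact lintegral_lebesgueMeasure p Ω (X_measurable p Ω u)

lemma ofReal_gagliardoMap_modular_inv_smul (u : X p Ω) (l : ℝ) :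
    ENNReal.ofReal ((gagliardoMap p Ω).modular (l⁻¹ • u)) =
      gagliardoModular p fun x => (u : Space N →ₘ[volume] ℝ) x / l := by
  rw [ofReal_gagliardoMap_modular]
  refine gagliardoModular_congr p ((X_coe_smul p Ω l⁻¹ u).trans (ae_of_all _ fun x => ?_))
  simp only [div_eq_inv_mul]

lemma ofReal_lebesgueMap_modular_inv_smul (u : X p Ω) (l : ℝ) :
    ENNReal.ofReal ((lebesgueMap p Ω).modular (l⁻¹ • u)) =
      ∫⁻ x in Ω, ENNReal.ofReal (|(u : Space N →ₘ[volume] ℝ) x / l| ^ p x x / p x x) := by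
  rw [ofReal_lebesgueMap_modular]
  refine lintegral_congr_ae (ae_restrict_of_ae ((X_coe_smul p Ω l⁻¹ u).mono fun x hx => ?_))
  simp only [hx, div_eq_inv_mul]

lemma isGauge_K : (gagliardoMap p Ω).IsGauge (K p Ω) := by
  refine ModularMap.isGauge_of_sInf _ (S := fun u => {l : ℝ | 0 < l ∧
    gagliardoModular p (fun x => (u : Space N →ₘ[volume] ℝ) x / l) < 1}) (fun u => rfl)
    (fun u l hl h => ⟨hl, ?_⟩) (fun u l hl => ⟨hl.1, ?_⟩)
  · rwa [← ofReal_gagliardoMap_modular_inv_smul p Ω, ENNReal.ofReal_lt_one]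
  · have := hl.2.le
    rwa [← ofReal_gagliardoMap_modular_inv_smul p Ω, ENNReal.ofReal_le_one] at this

lemma isGauge_k : (lebesgueMap p Ω).IsGauge (k p Ω) := by
  refine ModularMap.isGauge_of_sInf _ (S := fun u => {l : ℝ | 0 < l ∧
    ∫⁻ x in Ω, ENNReal.ofReal (|(u : Space N →ₘ[volume] ℝ) x / l| ^ p x x / p x x) ≤ 1})
    (fun u => rfl) (fun u l hl h => ⟨hl, ?_⟩) (fun u l hl => ⟨hl.1, ?_⟩)
  · rw [← ofReal_lebesgueMap_modular_inv_smul p Ω, ENNReal.ofReal_le_one]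
    exact h.le
  · have := hl.2
    rwa [← ofReal_lebesgueMap_modular_inv_smul p Ω, ENNReal.ofReal_le_one] at this

lemma gagliardoMap_upper_pos : 0 < (gagliardoMap p Ω).upper :=
  ModularMap.upper_pos _ (0, 0)

lemma lebesgueMap_upper_pos : 0 < (lebesgueMap p Ω).upper :=
  ModularMap.upper_pos _ 0

lemma X_norm_eq (u : X p Ω) : ‖u‖ = K p Ω u := rfl

/-- On the unit ball the modular is at most the norm. This is read off the infimum directly, because
`IsGauge.modular_le` presupposes continuity of the modular, which is deduced from the present limit.
-/
lemma tendsto_gagliardoMap_modular : Tendsto (gagliardoMap p Ω).modular (𝓝 0) (𝓝 0) := by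
  have key : ∀ u : X p Ω, ‖u‖ < 1 → (gagliardoMap p Ω).modular u ≤ ‖u‖ := by
    intro u hu
    refine le_of_forall_gt_imp_ge_of_dense fun ε hε => ?_
    have hlt : gagliardoNorm p (u : Space N →ₘ[volume] ℝ) < min ε 1 := lt_min hε hu
    obtain ⟨l, ⟨hl, hl1⟩, hlε⟩ :=
      exists_lt_of_csInf_lt (gagliardoNorm_set_nonempty p u.2.1.2) hlt
    rw [← ofReal_gagliardoMap_modular_inv_smul p Ω, ENNReal.ofReal_lt_one] at hl1
    have h1 := (gagliardoMap p Ω).modular_smul_le hl.le (hlε.le.trans (min_le_right _ _))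
      (l⁻¹ • u)
    rw [smul_smul, mul_inv_cancel₀ hl.ne', one_smul] at h1
    have h2 : l * (gagliardoMap p Ω).modular (l⁻¹ • u) ≤ l * 1 := by gcongr
    linarith [min_le_left ε 1]
  refine squeeze_zero' (Eventually.of_forall fun u => ModularMap.modular_nonneg _ u) ?_
    (tendsto_norm_zero (E := X p Ω))
  filter_upwards [Metric.ball_mem_nhds (0 : X p Ω) one_pos] with u hu
  exact key u (by simpa using hu)

lemma gagliardoEnergy_le_modular {b : ℝ} (hb : ∀ x y, p x y ≤ b) (f : Space N → ℝ) :
    gagliardoEnergy p f ≤ ENNReal.ofReal b * gagliardoModular p f := by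
  have hb0 : 0 < b := (p.pos 0 0).trans_le (hb 0 0)
  rw [gagliardoModular_eq, gagliardoEnergy_eq, ← lintegral_const_mul' _ _ ENNReal.ofReal_ne_top]
  refine lintegral_mono fun z => ?_
  rw [← ENNReal.ofReal_mul hb0.le]
  apply ENNReal.ofReal_le_ofReal
  have h0 := p.pos z.1 z.2
  have hw := p.weight_nonneg z
  have h1 : 1 ≤ b * (p z.1 z.2)⁻¹ := by
    rw [← div_eq_mul_inv, one_le_div h0]; exact hb _ _
  calc |f z.1 - f z.2| ^ p z.1 z.2 * p.weight z
      ≤ |f z.1 - f z.2| ^ p z.1 z.2 * p.weight z * (b * (p z.1 z.2)⁻¹) :=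
        le_mul_of_one_le_right (by positivity) h1
    _ = _ := by rw [AdmissibleExponent.weightDiv]; ring

/-- Turns norm bounds into the energy bounds on which the embedding estimates rely. -/
lemma exists_gagliardoEnergy_le (R : ℝ) :
    ∃ M : ℝ, ∀ u : X p Ω, ‖u‖ ≤ R →
      gagliardoEnergy p (u : Space N →ₘ[volume] ℝ) ≤ ENNReal.ofReal M := by
  obtain ⟨b, -, hb⟩ := p.exists_upper
  have hb0 : 0 < b := (p.pos 0 0).trans_le (hb 0 0)
  have hc := ((gagliardoMap p Ω).contDiff_modular (tendsto_gagliardoMap_modular p Ω)).continuous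
  refine ⟨b * (max R 0 + 1) ^ (gagliardoMap p Ω).upper, fun u hu => ?_⟩
  have hl1 : 1 ≤ max R 0 + 1 := by linarith [le_max_right R 0]
  have hl : 0 < max R 0 + 1 := by linarith
  have hul : K p Ω u ≤ max R 0 + 1 := by
    rw [X_norm_eq] at hu
    linarith [le_max_left R 0]
  have h1 := ((isGauge_K p Ω).le_iff hc hl u).1 hul
  have h2 := (gagliardoMap p Ω).modular_smul_le_of_one_le hl1 ((max R 0 + 1)⁻¹ • u)
  rw [smul_smul, mul_inv_cancel₀ hl.ne', one_smul] at h2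
  refine (gagliardoEnergy_le_modular p hb _).trans ?_
  rw [← ofReal_gagliardoMap_modular, ← ENNReal.ofReal_mul hb0.le]
  apply ENNReal.ofReal_le_ofReal
  have h3 : (max R 0 + 1) ^ (gagliardoMap p Ω).upper *
      (gagliardoMap p Ω).modular ((max R 0 + 1)⁻¹ • u) ≤
      (max R 0 + 1) ^ (gagliardoMap p Ω).upper * 1 := by gcongr
  rw [mul_one] at h3
  have := h2.trans h3
  gcongr

lemma lebesgueMap_modular_le {u : X p Ω} {C : ℝ} (hC : 0 ≤ C)
    (h : ∫⁻ x in Ω, ENNReal.ofReal (|(u : Space N →ₘ[volume] ℝ) x| ^ p x x) ≤ ENNReal.ofReal C) :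
    (lebesgueMap p Ω).modular u ≤ C := by
  rw [← ENNReal.ofReal_le_ofReal_iff hC, ofReal_lebesgueMap_modular]
  refine (lintegral_mono fun x => ?_).trans h
  exact ENNReal.ofReal_le_ofReal (div_le_self (by positivity) (p.one_le x x))

variable {Ω}

/-- The embedding bounds the modular by some `C` on the unit ball; scaling by `‖u‖ ≤ 1` improves
this to `C * ‖u‖`. -/
lemma tendsto_lebesgueMap_modular (hs0 : 0 < s) (hΩm : MeasurableSet Ω)
    (hΩb : Bornology.IsBounded Ω) :
    Tendsto (lebesgueMap p Ω).modular (𝓝 0) (𝓝 0) := by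
  obtain ⟨M, hM⟩ := exists_gagliardoEnergy_le p Ω 1
  obtain ⟨C, hC0, hC⟩ := exists_lintegral_rpow_le hs0 p hΩm hΩb M
  have h1 : ∀ u : X p Ω, ‖u‖ ≤ 1 → (lebesgueMap p Ω).modular u ≤ C := fun u hu =>
    lebesgueMap_modular_le p Ω hC0 (hC _ (X_measurable p Ω u) u.2.2 (hM u hu))
  have key : ∀ u : X p Ω, ‖u‖ < 1 → (lebesgueMap p Ω).modular u ≤ ‖u‖ * C := by
    intro u hu
    rcases eq_or_ne u 0 with rfl | h0
    · rw [norm_zero, zero_mul, ModularMap.modular_zero]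
    have hu0 : 0 < ‖u‖ := norm_pos_iff.2 h0
    have h2 := (lebesgueMap p Ω).modular_smul_le hu0.le hu.le (‖u‖⁻¹ • u)
    rw [smul_smul, mul_inv_cancel₀ hu0.ne', one_smul] at h2
    refine h2.trans ?_
    have := h1 (‖u‖⁻¹ • u) (by rw [norm_smul, norm_inv, norm_norm, inv_mul_cancel₀ hu0.ne'])
    gcongr
  refine squeeze_zero' (Eventually.of_forall fun u => ModularMap.modular_nonneg _ u) ?_
    (by simpa using (tendsto_norm_zero (E := X p Ω)).mul_const C)
  filter_upwards [Metric.ball_mem_nhds (0 : X p Ω) one_pos] with u hu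
  exact key u (by simpa using hu)

/-- The embedding makes the Lebesgue energy automatically finite, so only the Gagliardo energy has
to be checked for a limit. -/
lemma mem_X_of_gagliardoEnergy (hs0 : 0 < s) (hΩm : MeasurableSet Ω)
    (hΩb : Bornology.IsBounded Ω) {v : Space N →ₘ[volume] ℝ} (hv : ∀ᵐ x, x ∉ Ω → v x = 0)
    (hE : gagliardoEnergy p v < ⊤) : v ∈ X p Ω := by
  refine ⟨⟨?_, hE⟩, hv⟩
  obtain ⟨C, -, hC⟩ := exists_lintegral_rpow_le hs0 p hΩm hΩb (gagliardoEnergy p v).toReal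
  have h1 := hC v v.stronglyMeasurable.measurable hv (ENNReal.ofReal_toReal hE.ne).ge
  refine lt_of_eq_of_lt ?_ (h1.trans_lt ENNReal.ofReal_lt_top)
  rw [lebesgueEnergy, ← lintegral_indicator hΩm]
  refine lintegral_congr_ae (hv.mono fun x hx => ?_)
  by_cases h : x ∈ Ω
  · simp [h]
  · simp [h, hx h, Real.zero_rpow (p.pos x x).ne']

lemma X_integrable (hs0 : 0 < s) (hΩm : MeasurableSet Ω)
    (hΩb : Bornology.IsBounded Ω) (u : X p Ω) : Integrable (u : Space N →ₘ[volume] ℝ) :=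
  integrable_of_gagliardoEnergy hs0 hΩm hΩb (X_measurable p Ω u) u.2.2 u.2.1.2.ne

lemma exists_integral_abs_le (hs0 : 0 < s) (hΩm : MeasurableSet Ω)
    (hΩb : Bornology.IsBounded Ω) (R : ℝ) :
    ∃ C : ℝ, 0 ≤ C ∧ ∀ u : X p Ω, ‖u‖ ≤ R →
    ∫ x, |(u : Space N →ₘ[volume] ℝ) x| ≤ C := by
  obtain ⟨M, hM⟩ := exists_gagliardoEnergy_le p Ω R
  obtain ⟨C, hC0, hC⟩ := exists_lintegral_abs_le hs0 p hΩm hΩb M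
  exact ⟨C, hC0, fun u hu => integral_abs_le_of_lintegral (X_measurable p Ω u) hC0
    (hC _ (X_measurable p Ω u) u.2.2 (hM u hu))⟩

lemma exists_integral_abs_le_mul_norm (hs0 : 0 < s) (hΩm : MeasurableSet Ω)
    (hΩb : Bornology.IsBounded Ω) :
    ∃ C : ℝ, 0 ≤ C ∧ ∀ u : X p Ω,
    ∫ x, |(u : Space N →ₘ[volume] ℝ) x| ≤ C * ‖u‖ := by
  obtain ⟨C, hC0, hC⟩ := exists_integral_abs_le p hs0 hΩm hΩb 1
  refine ⟨C, hC0, fun u => ?_⟩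
  rcases eq_or_ne u 0 with rfl | h0
  · rw [norm_zero, mul_zero]
    refine (integral_eq_zero_of_ae ?_).le
    filter_upwards [AEEqFun.coeFn_zero (α := Space N) (μ := volume) (β := ℝ)] with x hx
    simp [hx]
  have hu0 : 0 < ‖u‖ := norm_pos_iff.2 h0
  have h1 := hC (‖u‖⁻¹ • u) (by rw [norm_smul, norm_inv, norm_norm, inv_mul_cancel₀ hu0.ne'])
  rw [integral_congr_ae ((X_coe_smul p Ω ‖u‖⁻¹ u).mono fun x hx => by
    simp only [hx, abs_mul, abs_of_pos (inv_pos.2 hu0)] :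
      _ =ᵐ[volume] fun x => ‖u‖⁻¹ * |(u : Space N →ₘ[volume] ℝ) x|), integral_const_mul,
    inv_mul_le_iff₀ hu0, mul_comm] at h1
  exact h1

/-! ### Completeness and compactness -/

/-- Lower semicontinuity of the modular with respect to convergence almost everywhere. -/
lemma gagliardoModular_le_of_tendsto (p : AdmissibleExponent N s) {f : ℕ → Space N → ℝ}
    {g : Space N → ℝ} (hf : ∀ n, Measurable (f n))
    (h : ∀ᵐ x, Tendsto (fun n => f n x) atTop (𝓝 (g x))) {C : ℝ≥0∞}
    (hC : ∀ᶠ n in atTop, gagliardoModular p (f n) ≤ C) : gagliardoModular p g ≤ C := by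
  have h2 : ∀ᵐ z : Space N × Space N, Tendsto (fun n => f n z.1) atTop (𝓝 (g z.1)) ∧
      Tendsto (fun n => f n z.2) atTop (𝓝 (g z.2)) :=
    (Measure.quasiMeasurePreserving_fst.ae h).and (Measure.quasiMeasurePreserving_snd.ae h)
  have hp := p.measurable
  have hw := p.weightDiv_measurable
  calc gagliardoModular p g
      = ∫⁻ z : Space N × Space N, liminf (fun n =>
          ENNReal.ofReal (|f n z.1 - f n z.2| ^ p z.1 z.2 * p.weightDiv z)) atTop := by
        rw [gagliardoModular_eq]
        refine lintegral_congr_ae (h2.mono fun z hz => ?_)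
        refine (Tendsto.liminf_eq ?_).symm
        exact (ENNReal.continuous_ofReal.tendsto _).comp
          ((((hz.1.sub hz.2).abs).rpow_const (Or.inr (p.pos _ _).le)).mul_const _)
    _ ≤ liminf (fun n => gagliardoModular p (f n)) atTop := by
        simp only [gagliardoModular_eq]
        exact lintegral_liminf_le fun n => by
          have := hf n
          fun_prop
    _ ≤ C := by
        refine (liminf_le_liminf hC).trans ?_
        simp

/-- A Cauchy sequence of `X` is Cauchy in `L¹`, hence converges a.e. along a subsequence; Fatou's
lemma for the modular upgrades this to convergence in `X`. -/
lemma X_complete (p : AdmissibleExponent N s) {Ω : Set (Space N)} (hs0 : 0 < s)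
    (hΩm : MeasurableSet Ω) (hΩb : Bornology.IsBounded Ω) : CompleteSpace (X p Ω) := by
  refine Metric.complete_of_cauchySeq_tendsto fun u hu => ?_
  have hc := ((gagliardoMap p Ω).contDiff_modular (tendsto_gagliardoMap_modular p Ω)).continuous
  have hint := X_integrable p hs0 hΩm hΩb
  obtain ⟨b, -, hb⟩ := p.exists_upper
  obtain ⟨C, hC0, hC⟩ := exists_integral_abs_le_mul_norm p hs0 hΩm hΩb
  set F : ℕ → (Space N →₁[volume] ℝ) := fun n => (hint (u n)).toL1 _ with hF
  have hdist : ∀ n m, dist (F n) (F m) ≤ C * dist (u n) (u m) := fun n m => by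
    refine le_trans (le_of_eq ?_) ((hC (u n - u m)).trans_eq (by rw [dist_eq_norm]))
    rw [dist_eq_norm, hF]
    simp only
    rw [← Integrable.toL1_sub _ _ (hint (u n)) (hint (u m)), L1.norm_eq_integral_norm]
    refine integral_congr_ae ?_
    filter_upwards [Integrable.coeFn_toL1 ((hint (u n)).sub (hint (u m))),
      X_coe_sub p Ω (u n) (u m)] with x h1 h2
    rw [h1, h2, Real.norm_eq_abs, Pi.sub_apply]
  have hFc : CauchySeq F := by
    rw [Metric.cauchySeq_iff'] at hu ⊢
    intro ε hε
    obtain ⟨n₀, hn₀⟩ := hu (ε / (C + 1)) (by positivity)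
    refine ⟨n₀, fun n hn => ?_⟩
    have h1 := hn₀ n hn
    rw [lt_div_iff₀ (by positivity)] at h1
    have h2 := hdist n n₀
    have h3 : 0 ≤ dist (u n) (u n₀) := dist_nonneg
    linarith
  obtain ⟨G, hG⟩ := cauchySeq_tendsto_of_complete hFc
  obtain ⟨ns, hns, hae⟩ := (tendstoInMeasure_of_tendsto_Lp hG).exists_seq_tendsto_ae
  set v : Space N →ₘ[volume] ℝ := (G : Space N →ₘ[volume] ℝ) with hv
  have hlim : ∀ᵐ x, Tendsto (fun i => (u (ns i) : Space N →ₘ[volume] ℝ) x) atTop (𝓝 (v x)) := by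
    have h1 : ∀ᵐ x, ∀ n, F n x = (u n : Space N →ₘ[volume] ℝ) x :=
      ae_all_iff.2 fun n => Integrable.coeFn_toL1 (hint (u n))
    filter_upwards [hae, h1] with x hx h1
    simpa only [h1] using hx
  have hv0 : ∀ᵐ x, x ∉ Ω → v x = 0 := by
    have h1 : ∀ᵐ x, ∀ n, x ∉ Ω → (u n : Space N →ₘ[volume] ℝ) x = 0 :=
      ae_all_iff.2 fun n => (u n).2.2
    filter_upwards [hlim, h1] with x hx h1 hxΩ
    refine tendsto_nhds_unique hx ?_
    simp only [h1 _ hxΩ]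
    exact tendsto_const_nhds
  -- Fatou in the second index of `u n - u (ns i)`: the Cauchy bound survives the passage to `v`.
  have hfatou : ∀ l : ℝ, 0 < l → ∃ n₀, ∀ n ≥ n₀,
      gagliardoModular p (fun x => ((u n : Space N →ₘ[volume] ℝ) x - v x) / l) ≤ 1 := by
    intro l hl
    obtain ⟨n₀, hn₀⟩ := Metric.cauchySeq_iff.1 hu l hl
    refine ⟨n₀, fun n hn => ?_⟩
    refine gagliardoModular_le_of_tendsto p (f := fun i x =>
      ((u n : Space N →ₘ[volume] ℝ) x - (u (ns i) : Space N →ₘ[volume] ℝ) x) / l)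
      (fun i => ?_) ?_ ?_
    · have h1 := X_measurable p Ω (u n)
      have h2 := X_measurable p Ω (u (ns i))
      fun_prop
    · filter_upwards [hlim] with x hx
      exact (hx.const_sub _).div_const l
    · filter_upwards [eventually_ge_atTop n₀] with i hi
      have h1 := hn₀ n hn (ns i) (hi.trans (hns.id_le i))
      rw [dist_eq_norm, X_norm_eq] at h1
      have h2 := ((isGauge_K p Ω).le_iff hc hl _).1 h1.le
      rw [← ENNReal.ofReal_le_one, ofReal_gagliardoMap_modular_inv_smul] at h2
      refine (gagliardoModular_congr p ?_).trans_le h2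
      filter_upwards [X_coe_sub p Ω (u n) (u (ns i))] with x hx
      rw [hx]
  have hmem : v ∈ X p Ω := by
    obtain ⟨n₀, hn₀⟩ := hfatou 1 one_pos
    have h1 := hn₀ n₀ le_rfl
    have hsub := AEEqFun.coeFn_sub (u n₀ : Space N →ₘ[volume] ℝ) v
    -- The bound at scale `1` gives `u n₀ - v` finite energy, and `v` is recovered as a difference
    -- of two elements of `X`.
    have h2 : (u n₀ : Space N →ₘ[volume] ℝ) - v ∈ X p Ω := by
      refine mem_X_of_gagliardoEnergy p hs0 hΩm hΩb ?_ ?_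
      · filter_upwards [hsub, (u n₀).2.2, hv0] with x hx h3 h4 hxΩ
        rw [hx, Pi.sub_apply, h3 hxΩ, h4 hxΩ, sub_zero]
      · rw [gagliardoEnergy_congr p hsub]
        refine (gagliardoEnergy_le_modular p hb _).trans_lt ?_
        refine ENNReal.mul_lt_top ENNReal.ofReal_lt_top (lt_of_le_of_lt ?_ ENNReal.one_lt_top)
        simp only [div_one] at h1
        exact h1
    have := (X p Ω).sub_mem (u n₀).2 h2
    rwa [sub_sub_cancel] at this
  refine ⟨⟨v, hmem⟩, Metric.tendsto_atTop.2 fun ε hε => ?_⟩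
  obtain ⟨n₀, hn₀⟩ := hfatou (ε / 2) (by positivity)
  refine ⟨n₀, fun n hn => ?_⟩
  have h1 : K p Ω (u n - ⟨v, hmem⟩) ≤ ε / 2 := by
    rw [(isGauge_K p Ω).le_iff hc (by positivity), ← ENNReal.ofReal_le_one,
      ofReal_gagliardoMap_modular_inv_smul]
    refine (gagliardoModular_congr p ?_).trans_le (hn₀ n hn)
    filter_upwards [X_coe_sub p Ω (u n) ⟨v, hmem⟩] with x hx
    rw [hx]
  rw [dist_eq_norm, X_norm_eq]
  linarith

/-- Bounded sequences of `X` have subsequences which converge in the variable exponent Lebesgue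
space. -/
lemma X_compact (p : AdmissibleExponent N s) {Ω : Set (Space N)} (hs0 : 0 < s)
    (hΩm : MeasurableSet Ω) (hΩb : Bornology.IsBounded Ω) (u : ℕ → X p Ω) (R : ℝ)
    (hu : ∀ n, ‖u n‖ ≤ R) : ∃ φ : ℕ → ℕ, StrictMono φ ∧
      Tendsto (fun x : ℕ × ℕ => (lebesgueMap p Ω).modular (u (φ x.1) - u (φ x.2)))
        atTop (𝓝 0) := by
  have hint := X_integrable p hs0 hΩm hΩb
  obtain ⟨C, hC0, hC⟩ := exists_integral_abs_le p hs0 hΩm hΩb R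
  obtain ⟨M, hM⟩ := exists_gagliardoEnergy_le p Ω (R + R)
  have hM' : ∀ n m, gagliardoEnergy p ((u n - u m : X p Ω) : Space N →ₘ[volume] ℝ) ≤
      ENNReal.ofReal M := fun n m => hM _ ((norm_sub_le _ _).trans (add_le_add (hu n) (hu m)))
  set z : ℕ → Space N := TopologicalSpace.denseSeq (Space N) with hz
  -- All averages over balls with centres in a dense sequence and radii `1 / (j + 1)` are recorded
  -- as one point of a countable product of compact intervals; its sequential compactness replaces a
  -- diagonal extraction.
  set av : ℕ → ℕ × ℕ → ℝ := fun n i =>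
    ∫ x in Metric.ball (z i.1) (1 / ((i.2 : ℝ) + 1)), (u n : Space N →ₘ[volume] ℝ) x with hav
  have hav_mem : ∀ n, av n ∈ Set.pi Set.univ fun _ : ℕ × ℕ => Set.Icc (-C) C := by
    intro n i _
    refine abs_le.1 (abs_integral_le_integral_abs.trans ?_)
    exact (setIntegral_le_integral (hint (u n)).abs
      (ae_of_all _ fun _ => abs_nonneg _)).trans (hC _ (hu n))
  obtain ⟨a, -, φ, hφ, ha⟩ := (isCompact_univ_pi fun _ : ℕ × ℕ =>
    isCompact_Icc (a := -C) (b := C)).tendsto_subseq hav_mem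
  refine ⟨φ, hφ, ?_⟩
  have hfst : Tendsto (fun x : ℕ × ℕ => x.1) atTop atTop := by
    rw [← prod_atTop_atTop_eq]; exact tendsto_fst
  have hsnd : Tendsto (fun x : ℕ × ℕ => x.2) atTop atTop := by
    rw [← prod_atTop_atTop_eq]; exact tendsto_snd
  have hdiff : ∀ i : ℕ × ℕ, Tendsto (fun x : ℕ × ℕ =>
      ∫ y in Metric.ball (z i.1) (1 / ((i.2 : ℝ) + 1)),
        ((u (φ x.1) - u (φ x.2) : X p Ω) : Space N →ₘ[volume] ℝ) y) atTop (𝓝 0) := by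
    intro i
    have hi : Tendsto (fun n => av (φ n) i) atTop (𝓝 (a i)) := (tendsto_pi_nhds.1 ha) i
    have h1 := (hi.comp hfst).sub (hi.comp hsnd)
    rw [sub_self] at h1
    refine h1.congr fun x => ?_
    simp only [Function.comp_apply, hav]
    rw [← integral_sub (hint _).integrableOn (hint _).integrableOn]
    exact (integral_congr_ae (ae_restrict_of_ae (X_coe_sub p Ω _ _))).symm
  rw [Metric.tendsto_nhds]
  intro ε hε
  -- Finitely many small averages make the `L¹` norm at most `δ`, which in turn makes the modular at
  -- most `ε / 2`.
  obtain ⟨δ, hδ, h1⟩ := exists_lintegral_rpow_le_of_integral_le hs0 p hΩm hΩb M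
    (show 0 < ε / 2 by positivity)
  obtain ⟨t, j, δ', hδ', h2⟩ := exists_integral_abs_le_of_averages hs0 p hΩm hΩb
    (TopologicalSpace.denseRange_denseSeq (Space N)) M hδ
  have h3 : ∀ᶠ x : ℕ × ℕ in atTop, ∀ i ∈ t,
      |∫ y in Metric.ball (z i) (1 / ((j : ℝ) + 1)),
        ((u (φ x.1) - u (φ x.2) : X p Ω) : Space N →ₘ[volume] ℝ) y| ≤ δ' := by
    rw [Filter.eventually_all_finset]
    intro i _
    filter_upwards [(hdiff (i, j)).abs.eventually_lt_const (by rwa [abs_zero])] with x hx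
    exact hx.le
  filter_upwards [h3] with x hx
  have hm := X_measurable p Ω (u (φ x.1) - u (φ x.2))
  have h0 := (u (φ x.1) - u (φ x.2)).2.2
  have hE := hM' (φ x.1) (φ x.2)
  rw [dist_zero_right, Real.norm_of_nonneg (ModularMap.modular_nonneg _ _)]
  have := lebesgueMap_modular_le p Ω (by positivity) (h1 _ hm h0 hE (h2 _ hm h0 hE hx))
  linarith

end

end FracVar

/-! ### The main theorem -/

theorem mainTheorem12 {N : ℕ} {s : ℝ} (hs0 : 0 < s) (hs1 : s < 1)
    (Ω : Set (FracVar.Space N)) (hΩo : IsOpen Ω) (hΩb : Bornology.IsBounded Ω)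
    (p : FracVar.AdmissibleExponent N s) :
    (∀ u : FracVar.X p Ω, FracVar.k p Ω u = 1 →
      ContDiffAt ℝ 1 (FracVar.K p Ω) u ∧ ContDiffAt ℝ 1 (FracVar.k p Ω) u ∧
        fderiv ℝ (FracVar.k p Ω) u ≠ 0) ∧
    FracVar.PalaisSmale (FracVar.K p Ω) (FracVar.k p Ω) := by
  have hcomplete := FracVar.X_complete p hs0 hΩo.measurableSet hΩb
  have hT := FracVar.tendsto_gagliardoMap_modular p Ω
  have hS := FracVar.tendsto_lebesgueMap_modular p hs0 hΩo.measurableSet hΩb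
  have hK := FracVar.isGauge_K p Ω
  have hk := FracVar.isGauge_k p Ω
  have hSc := ((FracVar.lebesgueMap p Ω).contDiff_modular hS).continuous
  refine ⟨fun u hu => ?_, ?_⟩
  · have hu0 : u ≠ 0 := by
      rintro rfl
      rw [hk.eq_zero_of_modular_eq_zero 0 (FracVar.ModularMap.modular_zero _)] at hu
      exact zero_ne_one hu
    have hk1 := hk.contDiffAt hS (u := u) (by rw [hu]; exact one_ne_zero)
    refine ⟨hK.contDiffAt hT (norm_ne_zero_iff.2 hu0), hk1, fun h => ?_⟩
    -- Euler's identity gives `k'(u) u = k(u) = 1`, so `k'(u)` cannot vanish.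
    have h1 := hk.fderiv_self hSc (hk1.differentiableAt one_ne_zero)
    rw [h, hu] at h1
    exact zero_ne_one h1
  · exact FracVar.palaisSmale_of_isGauge hK hT (FracVar.gagliardoMap_upper_pos p Ω)
      (FracVar.X_norm_eq p Ω) hk hS (FracVar.lebesgueMap_upper_pos p Ω)
      (FracVar.X_compact p hs0 hΩo.measurableSet hΩb)
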